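/- **Setting.** Let $X$ be a nonempty set, $n\in\mathbb N$, $\varepsilon,\delta\ge 0$ and $\alpha,\beta>0$. A *counting query* is a predicate $q:X\to\{0,1\}$; for a database $D=(x_1,\dots,x_n)\in X^n$ put $q(D)=\frac1n\sum_i q(x_i)$, and for a (discrete) distribution $\mathcal D$ on $X$, specified by its probability mass function, put $q(\mathcal D)=\mathbb E_{x\sim\mathcal D}[q(x)]$. For a set $Q$ of counting queries let $d_Q(\mathcal D,\mathcal D')=\sup_{q\in Q}|q(\mathcal D)-q(\mathcal D')|$, and let $\mathrm{VC}(Q)$ be the largest size of a finite set shattered by $Q$ ($\infty$ if there is no largest one). A randomized algorithm $A:X^n\to Y$ computes its output from the input and from coins drawn from a probability space; for each input its output is a random element of $Y$. Here $Y$ is $\mathbb R^Q$ or $\mathbb R^X$ with the product $\sigma$-algebra, or the set of distributions $p$ on $X$ with the $\sigma$-algebra generated by the maps $p\mapsto p(S)$, $S\subseteq X$. It is *$(\varepsilon,\delta)$-differentially private* if $\Pr[A(x)\in T]\le e^{\varepsilon}\Pr[A(x')\in T]+\delta$ for all $x,x'\in X^n$ that differ in one row and all measurable $T\subseteq Y$.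 "With probability at least $1-\beta$" means that the exceptional event has (outer) probability at most $\beta$. * $A:X^n\to\mathbb R^{Q}$ *releases $Q$ with $(\alpha,\beta)$-accuracy and sample complexity $n$* if for every $D\in X^n$, with probability at least $1-\beta$, the output $(a_q)_{q\in Q}=A(D)$ satisfies $|a_q-q(D)|\le\alpha$ for all $q\in Q$. * $A$ is an *$(\alpha,\beta)$-accurate distribution learner w.r.t. $Q$ with sample complexity $n$* if $A$ outputs distributions on $X$ and, for every distribution $\mathcal D$ on $X$, on $n$ i.i.d. samples from $\mathcal D$ its output $\mathcal D'$ satisfies $d_Q(\mathcal D,\mathcal D')\le\alpha$ with probability at least $1-\beta$ (over samples and coins). * For totally ordered $X$, $\mathrm{THRESH}_X=\{c_x:x\in X\}$ with $c_x(y)=1$ iff $y\le x$, and $F_{\mathcal D}(t)=\Pr_{x\sim\mathcal D}[x\le t]$. By a *CDF* on $X$ we mean a nondecreasing $F:X\to[0,1]$ with $F(\max X)=1$ if $X$ has a maximum (for finite $X$ these are exactly the functions $F_{\mathcal D}$). $A$ is an *$(\alpha,\beta)$-accurate distribution learner under Kolmogorov distance* if it always outputs a CDF $F$ and, for every $\mathcal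 D$, on $n$ i.i.d. samples from $\mathcal D$, $\sup_{x\in X}|F(x)-F_{\mathcal D}(x)|\le\alpha$ with probability at least $1-\beta$. **Theorem.** 1. Let $1\le\mathrm{VC}(Q)<\infty$ and $n\ge 256\,\mathrm{VC}(Q)\ln\!\big(\tfrac{48}{\alpha\beta}\big)/\alpha^2$. Suppose there is an $(\varepsilon,\delta)$-differentially private algorithm releasing $Q$ with $(\alpha,\beta)$-accuracy and sample complexity $n$, and that $X$ is countable or this algorithm has at most countably many possible outputs on each input. Then there is an $(\varepsilon,\delta)$-differentially private $(3\alpha,2\beta)$-accurate distribution learner w.r.t. $Q$ with sample complexity $n$. 2. Let $\varepsilon\le 1$. If there is an $(\varepsilon,\delta)$-differentially private $(\alpha,\beta)$-accurate distribution learner w.r.t. $Q$ with sample complexity $n$, then there is an $(\varepsilon,\delta)$-differentially private algorithm releasing $Q$ with $(\alpha,\beta)$-accuracy and sample complexity $9n$. 3. Let $X$ be totally ordered and $n\ge 2\ln(2/\beta)/\alpha^2$. Suppose there is an $(\varepsilon,\delta)$-differentially private algorithm releasing $\mathrm{THRESH}_X$ with $(\alpha,\beta)$-accuracy and sample complexity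 $n$, and that $X$ is countable or this algorithm has at most countably many possible outputs on each input. Then there are, with sample complexity $n$, an $(\varepsilon,\delta)$-differentially private $(3\alpha,2\beta)$-accurate distribution learner w.r.t. $\mathrm{THRESH}_X$ and an $(\varepsilon,\delta)$-differentially private $(2\alpha,2\beta)$-accurate distribution learner under Kolmogorov distance. -/

import Mathlib

open scoped ENNReal

universe u v w

namespace DPLearn

/-- The events about a random probability mass function on `X` are generated by the
evaluations `p ↦ Pr_{x ∼ p}[x ∈ S]`, for `S ⊆ X` (for countable `X`: by the point
evaluations `p ↦ p x`). -/
noncomputable instance instMeasurableSpacePMF (X : Type u) : MeasurableSpace (PMF X) :=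
  MeasurableSpace.comap (fun (p : PMF X) (S : Set X) => p.toOuterMeasure S)
    MeasurableSpace.pi

/-- A randomized algorithm with inputs in `I` and outputs in `Y`: it draws its coins from a
probability space and then computes its output from the input and the coins; for each
input the output is a random element of `Y`. -/
structure RandAlg (I : Type u) (Y : Type v) [MeasurableSpace Y] where
  /-- the outcomes of the coins -/
  Coins : Type w
  [measurableSpaceCoins : MeasurableSpace Coins]
  /-- the distribution of the coins -/
  law : MeasureTheory.Measure Coins
  [isProbabilityMeasure_law : MeasureTheory.IsProbabilityMeasure law]
  /-- the output on a given input and given coins -/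
  run : I → Coins → Y
  measurable_run : ∀ x, Measurable (run x)

/-- Probability, over the coins of `A`, that the output on input `x` lies in `T`. -/
noncomputable def RandAlg.prob {I : Type u} {Y : Type v} [MeasurableSpace Y]
    (A : RandAlg.{u, v, w} I Y) (x : I) (T : Set Y) : ℝ≥0∞ :=
  letI := A.measurableSpaceCoins
  A.law {ω | A.run x ω ∈ T}

/-- On every input the algorithm has at most countably many possible outputs. -/
def RandAlg.CountableOutputs {I : Type u} {Y : Type v} [MeasurableSpace Y]
    (A : RandAlg.{u, v, w} I Y) : Prop :=
  ∀ x, (Set.range (A.run x)).Countable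

/-- Databases that differ in (at most) one row. -/
def Neighbors {X : Type u} {n : ℕ} (x x' : Fin n → X) : Prop :=
  ∃ i, ∀ j, j ≠ i → x j = x' j

/-- `(ε, δ)`-differential privacy. -/
def RandAlg.IsDP {X : Type u} {n : ℕ} {Y : Type v} [MeasurableSpace Y]
    (A : RandAlg.{u, v, w} (Fin n → X) Y) (ε δ : ℝ) : Prop :=
  ∀ x x' : Fin n → X, Neighbors x x' → ∀ T : Set Y, MeasurableSet T →
    A.prob x T ≤ ENNReal.ofReal (Real.exp ε) * A.prob x' T + ENNReal.ofReal δ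

/-! A counting query `q : X → {0, 1}` is given by the set `{x | q x = 1}`. -/

/-- `q(D)`: the fraction of the rows of the database `D` that satisfy `q`. -/
noncomputable def empiricalValue {X : Type u} {n : ℕ} (q : Set X) (D : Fin n → X) : ℝ :=
  (∑ i, q.indicator (fun _ => (1 : ℝ)) (D i)) / n

/-- `q(p) = E_{x ∼ p}[q(x)]`. -/
noncomputable def populationValue {X : Type u} (q : Set X) (p : PMF X) : ℝ :=
  (p.toOuterMeasure q).toReal

/-- The distance `d_Q(p, p') = sup_{q ∈ Q} |q(p) - q(p')|`. -/
noncomputable def queryDist {X : Type u} (Q : Set (Set X)) (p p' : PMF X) : ℝ :=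
  ⨆ q : Q, |populationValue (q : Set X) p - populationValue (q : Set X) p'|

/-- Answers that are `α`-accurate for `Q` on the database `D`. -/
def AccurateAnswers {X : Type u} {n : ℕ} (Q : Set (Set X)) (α : ℝ) (D : Fin n → X)
    (a : Q → ℝ) : Prop :=
  ∀ q : Q, |a q - empiricalValue (q : Set X) D| ≤ α

/-- `(α, β)`-accurate query release for `Q` with sample complexity `n`: on every database the
answers fail to be `α`-accurate with probability at most `β`. -/
def IsQueryRelease {X : Type u} {n : ℕ} (Q : Set (Set X)) (α β : ℝ)
    (A : RandAlg.{u, u, w} (Fin n → X) (Q → ℝ)) : Prop :=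
  ∀ D : Fin n → X, A.prob D {a | ¬ AccurateAnswers Q α D a} ≤ ENNReal.ofReal β

/-- Probability, over a database `x` of `n` independent samples from `p` and over independent
coins of `A`, that the output lies in `T`. -/
noncomputable def RandAlg.sampleProb {X : Type u} {n : ℕ} {Y : Type v} [MeasurableSpace Y]
    (A : RandAlg.{u, v, w} (Fin n → X) Y) (p : PMF X) (T : Set Y) : ℝ≥0∞ :=
  ∑' x : Fin n → X, (∏ i, p (x i)) * A.prob x T

/-- `(α, β)`-accurate distribution learner with respect to `Q`, with sample complexity `n`. -/
def IsDistLearner {X : Type u} {n : ℕ} (Q : Set (Set X)) (α β : ℝ)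
    (A : RandAlg.{u, u, w} (Fin n → X) (PMF X)) : Prop :=
  ∀ p : PMF X, A.sampleProb p {p' | ¬ queryDist Q p p' ≤ α} ≤ ENNReal.ofReal β

/-- The finite set `S` is shattered by `Q`. -/
def ShatteredBy {X : Type u} (Q : Set (Set X)) (S : Finset X) : Prop :=
  ∀ T : Set X, T ⊆ S → ∃ q ∈ Q, (S : Set X) ∩ q = T

/-- The VC dimension of `Q` (infinite if arbitrarily large finite sets are shattered). -/
noncomputable def vcDim {X : Type u} (Q : Set (Set X)) : ℕ∞ :=
  ⨆ (S : Finset X) (_ : ShatteredBy Q S), (S.card : ℕ∞)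

/-- Threshold queries: `c_x(y) = 1` iff `y ≤ x`. -/
def thresh (X : Type u) [LinearOrder X] : Set (Set X) :=
  Set.range Set.Iic

/-- The cumulative distribution function `F_p(t) = Pr_{x ∼ p}[x ≤ t]`. -/
noncomputable def cdfOf {X : Type u} [LinearOrder X] (p : PMF X) (t : X) : ℝ :=
  (p.toOuterMeasure (Set.Iic t)).toReal

/-- Nondecreasing functions `F : X → [0, 1]` with `F (max X) = 1` if `X` has a maximum. On a
finite `X` these are exactly the cumulative distribution functions of distributions. -/
structure IsCDF {X : Type u} [LinearOrder X] (F : X → ℝ) : Prop where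
  monotone : Monotone F
  nonneg : ∀ x, 0 ≤ F x
  le_one : ∀ x, F x ≤ 1
  top : ∀ m, IsTop m → F m = 1

/-- `(α, β)`-accurate distribution learner with respect to Kolmogorov distance. -/
def IsKolmogorovLearner {X : Type u} [LinearOrder X] {n : ℕ} (α β : ℝ)
    (A : RandAlg.{u, u, w} (Fin n → X) (X → ℝ)) : Prop :=
  (∀ x ω, IsCDF (A.run x ω)) ∧
  ∀ p : PMF X, A.sampleProb p {F | ¬ (⨆ x, |F x - cdfOf p x|) ≤ α} ≤ ENNReal.ofReal β

end DPLearn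

namespace DPLearn

-- From release to learning, the tool is privacy-preserving postprocessing. Accurate answers to a
-- sample `D` are `α`-close to `q(D)`, and uniform convergence makes `q(D)` `α`-close to the
-- population value for all `q` at once, outside an event of probability `β`. Decode the answers
-- into the uniform distribution on any database `D'` whose values are `α`-close to them
-- (`exists_decoder`). Since `D` is itself a candidate, `q(D')` is within `2α` of `q(D)`, hence
-- within `3α` of the truth. For Kolmogorov distance no database is needed: a running supremum of
-- the truncated answers loses no accuracy, so the error stays `2α`.
--
-- Uniform convergence is proved twice. For finite VC dimension (`iidProb_vcDim_le`): ghost sample,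
-- random swaps, Sauer–Shelah, and a Chernoff bound for random signs. For thresholds
-- (`iidProb_thresh_le`) the rate must be free of such growth factors: along a chain `S_j` with
-- probabilities `P_j`, the process (empirical value minus `P_j`) divided by `1 - P_j` is a
-- martingale in `j`, so Doob's maximal inequality applied to its exponential gives a
-- Dvoretzky–Kiefer–Wolfowitz type bound `8 exp(-nα²)` (`iidProb_chain_le`).
--
-- From learning to release, run the learner on `n` rows drawn with replacement from `9n`: these are
-- i.i.d. samples from the empirical distribution, so the learned distribution answers the queries
-- on the database. A fixed row is drawn only `1/9` times on average, which keeps the privacy loss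
-- within `(ε, δ)` (`RandAlg.IsDP.subsample`).
--
-- Distributions are discrete, so sample probabilities are plain sums and samples raise no
-- measurability question. Measurability matters only for decoders: with countable `X` the decoder
-- is measurable, and with countably many outputs every map is as good as measurable
-- (`exists_measurableSet_agree`).

attribute [instance] RandAlg.measurableSpaceCoins RandAlg.isProbabilityMeasure_law

/-! ### Expectations over i.i.d. samples -/

/-- The expectation of `φ` over `n` independent samples from `p`. -/
noncomputable def iidExp {X : Type u} (p : PMF X) {n : ℕ} (φ : (Fin n → X) → ℝ≥0∞) : ℝ≥0∞ :=
  ∑' x : Fin n → X, (∏ i, p (x i)) * φ x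

section iidExp

variable {X : Type u} (p : PMF X) {n : ℕ}

lemma iidExp_zero (φ : (Fin 0 → X) → ℝ≥0∞) : iidExp p φ = φ Fin.elim0 := by
  unfold iidExp
  rw [tsum_eq_single Fin.elim0 fun x hx => absurd (Subsingleton.elim x _) hx]
  simp

lemma iidExp_succ (φ : (Fin (n + 1) → X) → ℝ≥0∞) :
    iidExp p φ = ∑' y, p y * iidExp p fun x : Fin n → X => φ (Fin.cons y x) := by
  unfold iidExp
  rw [← (Fin.consEquiv fun _ => X).tsum_eq, ENNReal.tsum_prod']
  simp [Fin.consEquiv, Fin.prod_univ_succ, mul_assoc, ENNReal.tsum_mul_left]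

lemma iidExp_mono {φ ψ : (Fin n → X) → ℝ≥0∞} (h : ∀ x, φ x ≤ ψ x) : iidExp p φ ≤ iidExp p ψ :=
  ENNReal.tsum_le_tsum fun x => by gcongr; exact h x

lemma iidExp_add (φ ψ : (Fin n → X) → ℝ≥0∞) :
    iidExp p (fun x => φ x + ψ x) = iidExp p φ + iidExp p ψ := by
  simp [iidExp, mul_add, ENNReal.tsum_add]

lemma iidExp_finset_sum {ι : Type*} (s : Finset ι) (φ : ι → (Fin n → X) → ℝ≥0∞) :
    iidExp p (fun x => ∑ j ∈ s, φ j x) = ∑ j ∈ s, iidExp p (φ j) := by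
  classical
  induction s using Finset.induction_on with
  | empty => simp [iidExp]
  | insert a s ha ih => simp [Finset.sum_insert ha, iidExp_add, ih]

lemma iidExp_const_mul (c : ℝ≥0∞) (φ : (Fin n → X) → ℝ≥0∞) :
    iidExp p (fun x => c * φ x) = c * iidExp p φ := by
  simp [iidExp, ← ENNReal.tsum_mul_left, mul_left_comm]

lemma iidExp_prod (f : X → ℝ≥0∞) :
    iidExp p (fun x : Fin n → X => ∏ i, f (x i)) = (∑' y, p y * f y) ^ n := by
  induction n with
  | zero => simp [iidExp_zero]
  | succ n ih =>
    simp only [iidExp_succ, Fin.prod_univ_succ, Fin.cons_zero, Fin.cons_succ, iidExp_const_mul, ih]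
    rw [pow_succ', ← ENNReal.tsum_mul_right]
    simp [mul_assoc]

lemma iidExp_const (c : ℝ≥0∞) : iidExp p (fun _ : Fin n → X => c) = c := by
  have := iidExp_prod p (n := n) (fun _ => 1)
  simp only [Finset.prod_const_one, mul_one, PMF.tsum_coe, one_pow] at this
  have h := iidExp_const_mul p (n := n) c (fun _ => 1)
  simpa [this] using h

end iidExp

/-! ### Values of queries -/

section queries

variable {X : Type u}

lemma toOuterMeasure_le_one (p : PMF X) (q : Set X) : p.toOuterMeasure q ≤ 1 := by
  rw [PMF.toOuterMeasure_apply, ← p.tsum_coe]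
  exact ENNReal.tsum_le_tsum fun x => Set.indicator_le_self' (fun _ _ => zero_le) x

lemma toOuterMeasure_ne_top (p : PMF X) (q : Set X) : p.toOuterMeasure q ≠ ∞ :=
  ((toOuterMeasure_le_one p q).trans_lt ENNReal.one_lt_top).ne

lemma populationValue_nonneg (q : Set X) (p : PMF X) : 0 ≤ populationValue q p :=
  ENNReal.toReal_nonneg

lemma populationValue_le_one (q : Set X) (p : PMF X) : populationValue q p ≤ 1 :=
  (ENNReal.toReal_mono ENNReal.one_ne_top (toOuterMeasure_le_one p q)).trans_eq ENNReal.toReal_one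

lemma abs_populationValue_sub_le_one (q : Set X) (p p' : PMF X) :
    |populationValue q p - populationValue q p'| ≤ 1 :=
  abs_sub_le_of_le_of_le (populationValue_nonneg q p) (populationValue_le_one q p)
    (populationValue_nonneg q p') (populationValue_le_one q p') |>.trans (by norm_num)

lemma bddAbove_queryDist (Q : Set (Set X)) (p p' : PMF X) :
    BddAbove (Set.range fun q : Q =>
      |populationValue (q : Set X) p - populationValue (q : Set X) p'|) :=
  ⟨1, by rintro _ ⟨q, rfl⟩; exact abs_populationValue_sub_le_one _ _ _⟩

lemma le_queryDist {Q : Set (Set X)} {q : Set X} (hq : q ∈ Q) (p p' : PMF X) :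
    |populationValue q p - populationValue q p'| ≤ queryDist Q p p' :=
  le_ciSup (bddAbove_queryDist Q p p') ⟨q, hq⟩

lemma queryDist_le {Q : Set (Set X)} {p p' : PMF X} {a : ℝ} (ha : 0 ≤ a)
    (h : ∀ q ∈ Q, |populationValue q p - populationValue q p'| ≤ a) : queryDist Q p p' ≤ a :=
  Real.iSup_le (fun q => h q q.2) ha

lemma measurable_populationValue (q : Set X) : Measurable fun p : PMF X => populationValue q p := by
  have h : Measurable fun (p : PMF X) (S : Set X) => p.toOuterMeasure S :=
    comap_measurable _
  exact ((measurable_pi_apply q).comp h).ennreal_toReal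

/-- The uniform distribution on the rows of a database. -/
noncomputable def empiricalPMF {n : ℕ} [NeZero n] (D : Fin n → X) : PMF X :=
  (PMF.uniformOfFintype (Fin n)).map D

lemma populationValue_empiricalPMF {n : ℕ} [NeZero n] (q : Set X) (D : Fin n → X) :
    populationValue q (empiricalPMF D) = empiricalValue q D := by
  classical
  rw [populationValue, empiricalPMF, PMF.toOuterMeasure_map_apply,
    PMF.toOuterMeasure_uniformOfFintype_apply, empiricalValue, ENNReal.toReal_div]
  simp [Fintype.card_subtype, Set.indicator_apply]

lemma tsum_empiricalPMF {n : ℕ} [NeZero n] (D : Fin n → X) (ψ : X → ℝ≥0∞) :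
    ∑' y, empiricalPMF D y * ψ y = (n : ℝ≥0∞)⁻¹ * ∑ j, ψ (D j) := by
  simp only [empiricalPMF, PMF.map_apply, ← ENNReal.tsum_mul_right]
  rw [ENNReal.tsum_comm, tsum_fintype, Finset.mul_sum]
  refine Finset.sum_congr rfl fun j _ => ?_
  rw [tsum_eq_single (D j) fun y hy => by simp [hy]]
  simp

lemma iidExp_empiricalPMF {N n : ℕ} [NeZero N] (D : Fin N → X) (φ : (Fin n → X) → ℝ≥0∞) :
    iidExp (empiricalPMF D) φ = ((N : ℝ≥0∞)⁻¹) ^ n * ∑ I : Fin n → Fin N, φ (D ∘ I) := by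
  induction n with
  | zero =>
    simp only [iidExp_zero, pow_zero, one_mul, Fintype.sum_unique]
    congr 1
    exact Subsingleton.elim _ _
  | succ n ih =>
    simp only [iidExp_succ, ih]
    rw [tsum_empiricalPMF D fun y => ((N : ℝ≥0∞)⁻¹) ^ n * ∑ I : Fin n → Fin N, φ (Fin.cons y (D ∘ I)),
      ← (Fin.consEquiv fun _ => Fin N).sum_comp, Fintype.sum_prod_type,
      ← Finset.mul_sum, pow_succ', mul_assoc]
    refine congrArg _ (congrArg _ (Finset.sum_congr rfl fun j _ =>
      Finset.sum_congr rfl fun I _ => congrArg φ ?_))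
    funext k
    refine Fin.cases ?_ (fun k => ?_) k <;> simp [Fin.consEquiv]

end queries

lemma RandAlg.sampleProb_eq {X : Type u} {n : ℕ} {Y : Type v} [MeasurableSpace Y]
    (A : RandAlg.{u, v, w} (Fin n → X) Y) (p : PMF X) (T : Set Y) :
    A.sampleProb p T = iidExp p fun x => A.prob x T := rfl

section prob

variable {I : Type u} {Y : Type v} [MeasurableSpace Y] (A : RandAlg.{u, v, w} I Y) (x : I)

lemma RandAlg.prob_le_one (T : Set Y) : A.prob x T ≤ 1 := MeasureTheory.prob_le_one

lemma RandAlg.prob_ne_top (T : Set Y) : A.prob x T ≠ ∞ := MeasureTheory.measure_ne_top _ _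

lemma RandAlg.prob_mono {S T : Set Y} (h : S ⊆ T) : A.prob x S ≤ A.prob x T :=
  MeasureTheory.measure_mono fun _ hω => h hω

end prob

lemma RandAlg.sampleProb_le_one {X : Type u} {n : ℕ} {Y : Type v} [MeasurableSpace Y]
    (A : RandAlg.{u, v, w} (Fin n → X) Y) (p : PMF X) (T : Set Y) : A.sampleProb p T ≤ 1 :=
  (iidExp_mono p fun x => A.prob_le_one x T).trans_eq (iidExp_const p 1)

/-- The algorithm that ignores its input and its coins. -/
noncomputable def RandAlg.const (I : Type u) {Y : Type v} [MeasurableSpace Y] (y : Y) :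
    RandAlg.{u, v, w} I Y where
  Coins := PUnit
  law := MeasureTheory.Measure.dirac PUnit.unit
  run _ _ := y
  measurable_run _ := measurable_const

lemma RandAlg.prob_const (I : Type u) {Y : Type v} [MeasurableSpace Y] (y : Y) (x : I)
    {T : Set Y} (hy : y ∉ T) : (RandAlg.const.{u, v, w} I y).prob x T = 0 := by
  change MeasureTheory.Measure.dirac PUnit.unit {_ω : PUnit | y ∈ T} = 0
  simp [hy]

lemma le_exp_mul_add {ε δ : ℝ} (hε : 0 ≤ ε) (a : ℝ≥0∞) :
    a ≤ ENNReal.ofReal (Real.exp ε) * a + ENNReal.ofReal δ := by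
  refine le_add_right ?_
  have : (1 : ℝ≥0∞) ≤ ENNReal.ofReal (Real.exp ε) := by
    simpa using Real.one_le_exp hε
  simpa using mul_le_mul_left this a

lemma RandAlg.isDP_const {X : Type u} {n : ℕ} {Y : Type v} [MeasurableSpace Y] {ε : ℝ}
    (hε : 0 ≤ ε) (δ : ℝ) (y : Y) :
    (RandAlg.const.{u, v, w} (Fin n → X) y).IsDP ε δ :=
  fun _ _ _ _ _ => le_exp_mul_add hε _

/-! ### Privacy of subsampling -/

section subsample

variable {X : Type u}

/-- The algorithm that runs `A` on `n` rows drawn independently and uniformly from the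
database. -/
noncomputable def RandAlg.subsample {n : ℕ} {Y : Type v} [MeasurableSpace Y]
    (A : RandAlg.{u, v, w} (Fin n → X) Y) (N : ℕ) [NeZero N] :
    RandAlg.{u, v, w} (Fin N → X) Y where
  Coins := (Fin n → Fin N) × A.Coins
  law := (PMF.uniformOfFintype (Fin n → Fin N)).toMeasure.prod A.law
  run D c := A.run (D ∘ c.1) c.2
  measurable_run D := measurable_from_prod_countable_right fun I => A.measurable_run (D ∘ I)

lemma RandAlg.law_prod_subsample {n : ℕ} {Y : Type v} [MeasurableSpace Y]
    (A : RandAlg.{u, v, w} (Fin n → X) Y) (N : ℕ) [NeZero N] (I : Fin n → Fin N)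
    (S : Set A.Coins) :
    (A.subsample N).law ({I} ×ˢ S) = ((N : ℝ≥0∞)⁻¹) ^ n * A.law S := by
  change ((PMF.uniformOfFintype (Fin n → Fin N)).toMeasure.prod A.law) _ = _
  rw [MeasureTheory.Measure.prod_prod, PMF.toMeasure_apply_singleton _ _ (measurableSet_singleton _)]
  simp [ENNReal.inv_pow]

lemma RandAlg.subsample_setOf {n : ℕ} {Y : Type v} [MeasurableSpace Y]
    (A : RandAlg.{u, v, w} (Fin n → X) Y) (N : ℕ) [NeZero N] (D : Fin N → X) (T : Set Y) :
    {c | (A.subsample N).run D c ∈ T} =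
      ⋃ I : Fin n → Fin N, {I} ×ˢ {ω | A.run (D ∘ I) ω ∈ T} := by
  ext c
  refine Iff.trans ?_ Set.mem_iUnion.symm
  exact ⟨fun h => ⟨c.1, rfl, h⟩, fun ⟨I, hI, h⟩ => by subst hI; exact h⟩

lemma RandAlg.prob_subsample_le {n : ℕ} {Y : Type v} [MeasurableSpace Y]
    (A : RandAlg.{u, v, w} (Fin n → X) Y) (N : ℕ) [NeZero N] (D : Fin N → X) (T : Set Y) :
    (A.subsample N).prob D T ≤
      ((N : ℝ≥0∞)⁻¹) ^ n * ∑ I : Fin n → Fin N, A.prob (D ∘ I) T := by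
  unfold RandAlg.prob
  rw [RandAlg.subsample_setOf, Finset.mul_sum]
  refine (MeasureTheory.measure_iUnion_le _).trans_eq ?_
  rw [tsum_fintype]
  exact Finset.sum_congr rfl fun I _ => A.law_prod_subsample N I _

lemma RandAlg.prob_subsample {n : ℕ} {Y : Type v} [MeasurableSpace Y]
    (A : RandAlg.{u, v, w} (Fin n → X) Y) (N : ℕ) [NeZero N] (D : Fin N → X) {T : Set Y}
    (hT : MeasurableSet T) :
    (A.subsample N).prob D T =
      ((N : ℝ≥0∞)⁻¹) ^ n * ∑ I : Fin n → Fin N, A.prob (D ∘ I) T := by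
  unfold RandAlg.prob
  rw [RandAlg.subsample_setOf, Finset.mul_sum]
  refine (MeasureTheory.measure_iUnion (α := (Fin n → Fin N) × A.Coins) ?_ ?_).trans ?_
  · intro I J hIJ
    exact Set.disjoint_left.2 fun c h h' => hIJ (h.1.symm.trans h'.1)
  · exact fun I => (measurableSet_singleton I).prod (A.measurable_run _ hT)
  · rw [tsum_fintype]
    exact Finset.sum_congr rfl fun I _ => A.law_prod_subsample N I _

/-- The effect of a single uniform draw. Compare the changed row with the row of `D'` where `h` is
smallest: that minimum is at most `h (D' i)` and at most the average, so the change costs only `(exp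
ε - 1)` times the average, plus `δ`. -/
lemma sum_le_of_forall_le {N : ℕ} [NeZero N] {ε δ : ℝ} {h : X → ℝ}
    (hε : 0 ≤ ε) (hh : ∀ y y', h y ≤ Real.exp ε * h y' + δ)
    {D D' : Fin N → X} {i : Fin N} (hD : ∀ j, j ≠ i → D j = D' j) :
    ∑ j, h (D j) ≤ (1 + (Real.exp ε - 1) / N) * ∑ j, h (D' j) + δ := by
  obtain ⟨k, -, hk⟩ := Finset.exists_min_image Finset.univ (fun j => h (D' j)) ⟨i, by simp⟩
  have hN : (0 : ℝ) < N := by exact_mod_cast NeZero.pos N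
  have hmin : N * h (D' k) ≤ ∑ j, h (D' j) := by
    simpa using Finset.card_nsmul_le_sum Finset.univ (fun j => h (D' j)) (h (D' k)) hk
  have hmin' : h (D' k) ≤ (∑ j, h (D' j)) / N := by rwa [le_div_iff₀' hN]
  have h1 : ∑ j, h (D j) - ∑ j, h (D' j) = h (D i) - h (D' i) := by
    rw [← Finset.sum_sub_distrib]
    refine Finset.sum_eq_single i (fun j _ hj => ?_) (by simp)
    simp [hD j hj]
  have h2 := hh (D i) (D' k)
  have h3 := hk i (Finset.mem_univ i)
  have h4 := mul_le_mul_of_nonneg_left hmin' (sub_nonneg.2 (Real.one_le_exp hε))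
  have h5 : (Real.exp ε - 1) * ((∑ j, h (D' j)) / N) =
    (Real.exp ε - 1) / N * ∑ j, h (D' j) := by ring
  linarith

/-- Hybrid argument over the draws: moving one draw from `D` to `D'` multiplies the average by at
most `1 + (exp ε - 1) / N` and adds `δ / N`. In the inductive step the first draw is frozen while
the others move, and then it moves itself. -/
lemma sum_comp_le_of_neighbors {N : ℕ} [NeZero N] {ε δ : ℝ} (hε : 0 ≤ ε) (hδ : 0 ≤ δ)
    {D D' : Fin N → X} {i : Fin N} (hD : ∀ j, j ≠ i → D j = D' j) {n : ℕ}
    (g : (Fin n → X) → ℝ) (hg : ∀ x x', Neighbors x x' → g x ≤ Real.exp ε * g x' + δ) :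
    ∑ I : Fin n → Fin N, g (D ∘ I) ≤
      (1 + (Real.exp ε - 1) / N) ^ n * ∑ I : Fin n → Fin N, g (D' ∘ I) +
        N ^ n * (n * (δ / N) * (1 + (Real.exp ε - 1) / N) ^ n) := by
  have hN : (0 : ℝ) < N := by exact_mod_cast NeZero.pos N
  set a := 1 + (Real.exp ε - 1) / N with ha
  have ha1 : 1 ≤ a := by
    have := sub_nonneg.2 (Real.one_le_exp hε)
    rw [ha]
    have := div_nonneg this hN.le
    linarith
  induction n with
  | zero =>
    have h (I : Fin 0 → Fin N) : g (D ∘ I) = g (D' ∘ I) :=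
      congrArg g (Subsingleton.elim (α := Fin 0 → X) _ _)
    simp only [h]
    simp
  | succ n ih =>
    have hcons (E : Fin N → X) (j : Fin N) (I : Fin n → Fin N) :
        E ∘ (Fin.consEquiv fun _ => Fin N) (j, I) = Fin.cons (E j) (E ∘ I) := by
      funext k
      refine Fin.cases ?_ (fun k => ?_) k <;> simp [Fin.consEquiv]
    have hsum (E : Fin N → X) : ∑ I : Fin (n + 1) → Fin N, g (E ∘ I) =
        ∑ j, ∑ I : Fin n → Fin N, g (Fin.cons (E j) (E ∘ I)) := by
      rw [← (Fin.consEquiv fun _ => Fin N).sum_comp, Fintype.sum_prod_type]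
      simp only [hcons]
    rw [hsum, hsum]
    calc ∑ j, ∑ I : Fin n → Fin N, g (Fin.cons (D j) (D ∘ I))
        ≤ ∑ j, (a ^ n * ∑ I : Fin n → Fin N, g (Fin.cons (D j) (D' ∘ I)) +
            N ^ n * (n * (δ / N) * a ^ n)) := by
          refine Finset.sum_le_sum fun j _ => ih (fun x => g (Fin.cons (D j) x)) ?_
          rintro x x' ⟨k, hk⟩
          refine hg _ _ ⟨k.succ, fun l => ?_⟩
          refine Fin.cases (by simp) (fun l hl => ?_) l
          simpa using hk l fun h => hl (by rw [h])
      _ = a ^ n * ∑ I : Fin n → Fin N, ∑ j, g (Fin.cons (D j) (D' ∘ I)) +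
            N ^ (n + 1) * (n * (δ / N) * a ^ n) := by
          rw [Finset.sum_add_distrib, ← Finset.mul_sum, Finset.sum_comm]
          simp only [Finset.sum_const, Finset.card_univ, Fintype.card_fin, nsmul_eq_mul]
          ring
      _ ≤ a ^ n * ∑ I : Fin n → Fin N, (a * ∑ j, g (Fin.cons (D' j) (D' ∘ I)) + δ) +
            N ^ (n + 1) * (n * (δ / N) * a ^ n) := by
          gcongr with I
          refine sum_le_of_forall_le (h := fun y => g (Fin.cons y (D' ∘ I))) hε
            (fun y y' => hg _ _ ⟨0, fun l => ?_⟩) hD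
          exact Fin.cases (by simp) (fun l _ => by simp) l
      _ = a ^ (n + 1) * ∑ j, ∑ I : Fin n → Fin N, g (Fin.cons (D' j) (D' ∘ I)) +
            N ^ (n + 1) * (((n + 1 : ℕ) : ℝ) * (δ / N) * a ^ n) := by
          rw [Finset.sum_add_distrib, ← Finset.mul_sum, Finset.sum_comm]
          simp only [Finset.sum_const, Finset.card_univ, Fintype.card_fun, Fintype.card_fin,
            nsmul_eq_mul]
          push_cast
          field_simp
          ring
      _ ≤ _ := by
          have : a ^ n ≤ a ^ (n + 1) := pow_le_pow_right₀ ha1 n.le_succ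
          gcongr

lemma RandAlg.IsDP.toReal_prob_le {n : ℕ} {Y : Type v} [MeasurableSpace Y]
    {A : RandAlg.{u, v, w} (Fin n → X) Y} {ε δ : ℝ} (hδ : 0 ≤ δ) (hA : A.IsDP ε δ)
    {x x' : Fin n → X} (h : Neighbors x x') {T : Set Y} (hT : MeasurableSet T) :
    (A.prob x T).toReal ≤ Real.exp ε * (A.prob x' T).toReal + δ := by
  have := ENNReal.toReal_mono (by finiteness [A.prob_ne_top x' T]) (hA x x' h T hT)
  rwa [ENNReal.toReal_add (by finiteness [A.prob_ne_top x' T]) (by finiteness),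
    ENNReal.toReal_mul, ENNReal.toReal_ofReal (Real.exp_pos _).le,
    ENNReal.toReal_ofReal hδ] at this

/-- This is where `ε ≤ 1` enters: it gives `exp ε - 1 ≤ 2ε`, so `n` draws out of `9n` rows compound
to at most `exp (2ε/9)`. -/
lemma one_add_div_pow_le {ε : ℝ} (hε : 0 ≤ ε) (hε1 : ε ≤ 1) (n : ℕ) [NeZero n] :
    (1 + (Real.exp ε - 1) / ((9 * n : ℕ) : ℝ)) ^ n ≤ Real.exp (2 / 9 * ε) := by
  have hn : (0 : ℝ) < n := by exact_mod_cast NeZero.pos n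
  have h1 : Real.exp ε - 1 ≤ 2 * ε := by
    have h := Real.abs_exp_sub_one_le (x := ε) (by rwa [abs_of_nonneg hε])
    rw [abs_of_nonneg hε] at h
    exact (le_abs_self _).trans h
  calc (1 + (Real.exp ε - 1) / ((9 * n : ℕ) : ℝ)) ^ n
      ≤ (Real.exp (2 / 9 * ε / n)) ^ n := by
        have h0 : 0 ≤ (Real.exp ε - 1) := sub_nonneg.2 (Real.one_le_exp hε)
        refine pow_le_pow_left₀ (by positivity) ?_ n
        refine le_trans ?_ (Real.add_one_le_exp _)
        rw [add_comm]
        refine add_le_add_left ?_ 1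
        push_cast
        rw [div_le_div_iff₀ (by positivity) hn]
        nlinarith
    _ = _ := by
        rw [← Real.exp_nat_mul]
        congr 1
        field_simp

lemma RandAlg.IsDP.subsample {n : ℕ} [NeZero n] {Y : Type v} [MeasurableSpace Y]
    {A : RandAlg.{u, v, w} (Fin n → X) Y} {ε δ : ℝ} (hε : 0 ≤ ε) (hε1 : ε ≤ 1) (hδ : 0 ≤ δ)
    (hA : A.IsDP ε δ) : (A.subsample (9 * n)).IsDP ε δ := by
  have hn : (0 : ℝ) < n := by exact_mod_cast NeZero.pos n
  obtain ⟨N, hNdef⟩ : ∃ N, N = 9 * n := ⟨_, rfl⟩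
  have : NeZero N := ⟨by rw [hNdef]; exact NeZero.ne _⟩
  have hexp := one_add_div_pow_le hε hε1 n
  rw [← hNdef] at hexp
  suffices (A.subsample N).IsDP ε δ by subst hNdef; exact this
  rintro D D' ⟨i, hD⟩ T hT
  have hN : (0 : ℝ) < N := by exact_mod_cast NeZero.pos N
  have key := sum_comp_le_of_neighbors hε hδ hD (fun x => (A.prob x T).toReal)
    fun x x' h => hA.toReal_prob_le hδ h hT
  have hpow : (1 + (Real.exp ε - 1) / N) ^ n ≤ Real.exp ε :=
    hexp.trans (Real.exp_le_exp.2 (by linarith))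
  have hprob (E : Fin N → X) : ((A.subsample N).prob E T).toReal =
      ((N : ℝ)⁻¹) ^ n * ∑ I : Fin n → Fin N, (A.prob (E ∘ I) T).toReal := by
    rw [A.prob_subsample N E hT, ENNReal.toReal_mul, ENNReal.toReal_sum fun I _ => A.prob_ne_top _ _]
    simp
  -- The additive errors total `δ / 9` before amplification, and the amplification is at most `exp ε
  -- ≤ e ≤ 9`.
  have hδ' : n * (δ / N) * (1 + (Real.exp ε - 1) / N) ^ n ≤ δ := by
    have h3 : Real.exp ε ≤ 9 := by
      have := Real.exp_one_lt_d9
      have := Real.exp_le_exp.2 hε1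
      linarith
    calc n * (δ / N) * (1 + (Real.exp ε - 1) / N) ^ n ≤ n * (δ / N) * 9 := by
          gcongr
          exact hpow.trans h3
      _ = δ := by
          rw [hNdef]
          push_cast
          field_simp
  have hreal : ((A.subsample N).prob D T).toReal ≤
      Real.exp ε * ((A.subsample N).prob D' T).toReal + δ := by
    rw [hprob, hprob]
    calc _ ≤ ((N : ℝ)⁻¹) ^ n * ((1 + (Real.exp ε - 1) / N) ^ n *
            ∑ I : Fin n → Fin N, (A.prob (D' ∘ I) T).toReal +
              N ^ n * (n * (δ / N) * (1 + (Real.exp ε - 1) / N) ^ n)) := by gcongr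
      _ = (1 + (Real.exp ε - 1) / N) ^ n * (((N : ℝ)⁻¹) ^ n *
            ∑ I : Fin n → Fin N, (A.prob (D' ∘ I) T).toReal) +
              n * (δ / N) * (1 + (Real.exp ε - 1) / N) ^ n := by
          rw [mul_add, ← mul_assoc (((N : ℝ)⁻¹) ^ n) (N ^ n : ℝ), ← mul_pow,
            inv_mul_cancel₀ hN.ne', one_pow]
          ring
      _ ≤ _ := by gcongr
  rw [← ENNReal.ofReal_toReal ((A.subsample N).prob_ne_top D T),
    ← ENNReal.ofReal_toReal ((A.subsample N).prob_ne_top D' T),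
    ← ENNReal.ofReal_mul (Real.exp_pos _).le, ← ENNReal.ofReal_add (by positivity) hδ]
  exact ENNReal.ofReal_le_ofReal hreal

end subsample

/-! ### Postprocessing by a measurable map -/

/-- Apply `f` to the output of `A`. -/
noncomputable def RandAlg.map {I : Type u} {Y : Type v} {Z : Type*} [MeasurableSpace Y]
    [MeasurableSpace Z] (A : RandAlg.{u, v, w} I Y) (f : Y → Z)
    (hf : ∀ x, Measurable fun ω => f (A.run x ω)) : RandAlg I Z where
  Coins := A.Coins
  law := A.law
  run x ω := f (A.run x ω)
  measurable_run := hf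

lemma RandAlg.prob_map {I : Type u} {Y : Type v} {Z : Type*} [MeasurableSpace Y]
    [MeasurableSpace Z] (A : RandAlg.{u, v, w} I Y) (f : Y → Z)
    (hf : ∀ x, Measurable fun ω => f (A.run x ω)) (x : I) (T : Set Z) :
    (A.map f hf).prob x T = A.prob x (f ⁻¹' T) := rfl

lemma exists_queryRelease_of_distLearner {X : Type u} {n : ℕ} {ε δ α β : ℝ}
    (hε : 0 ≤ ε) (hε1 : ε ≤ 1) (hδ : 0 ≤ δ) (hα : 0 ≤ α) (Q : Set (Set X))
    (A : RandAlg.{u, u, w} (Fin n → X) (PMF X)) (hA : A.IsDP ε δ) (hQ : IsDistLearner Q α β A) :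
    ∃ B : RandAlg.{u, u, w} (Fin (9 * n) → X) (Q → ℝ), B.IsDP ε δ ∧ IsQueryRelease Q α β B := by
  rcases Nat.eq_zero_or_pos n with rfl | hn
  -- On the empty database every empirical value is `0 / 0 = 0`, so the constant answer `0` is
  -- exact.
  · refine ⟨RandAlg.const _ 0, RandAlg.isDP_const hε δ 0, fun D => ?_⟩
    rw [RandAlg.prob_const]
    · exact zero_le
    · simp [AccurateAnswers, empiricalValue, hα]
  · have : NeZero n := ⟨hn.ne'⟩
    have hf : Measurable fun (p : PMF X) (q : Q) => populationValue (q : Set X) p :=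
      measurable_pi_lambda _ fun q => measurable_populationValue _
    refine ⟨(A.subsample (9 * n)).map (fun p q => populationValue q p)
      fun x => hf.comp ((A.subsample (9 * n)).measurable_run x), fun D D' h T hT => ?_, fun D => ?_⟩
    · exact hA.subsample hε hε1 hδ D D' h _ (hf hT)
    · refine le_trans ?_ (hQ (empiricalPMF D))
      rw [RandAlg.prob_map, RandAlg.sampleProb_eq, iidExp_empiricalPMF]
      -- The failure event involves a supremum over an arbitrary `Q` and need not be measurable;
      -- countable subadditivity of the outer measure is enough here.
      refine ((A.subsample (9 * n)).prob_mono D ?_).trans (A.prob_subsample_le (9 * n) D _)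
      intro p hp hd
      refine hp fun q => ?_
      rw [← populationValue_empiricalPMF, abs_sub_comm]
      exact (le_queryDist q.2 _ _).trans hd

/-! ### A maximal inequality for chains of queries -/

/-- Probability of the event `E` over `n` independent samples from `p`. -/
noncomputable def iidProb {X : Type u} (p : PMF X) {n : ℕ} (E : Set (Fin n → X)) : ℝ≥0∞ :=
  iidExp p (E.indicator fun _ => 1)

section iidProb

variable {X : Type u} (p : PMF X) {n : ℕ}

lemma iidProb_mono {E F : Set (Fin n → X)} (h : E ⊆ F) : iidProb p E ≤ iidProb p F :=
  iidExp_mono p fun x => Set.indicator_le_indicator_of_subset h (fun _ => zero_le) x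

lemma iidProb_le_one (E : Set (Fin n → X)) : iidProb p E ≤ 1 :=
  (iidExp_mono p fun x => Set.indicator_le_self' (fun _ _ => zero_le) x).trans_eq (iidExp_const p 1)

lemma iidProb_union_le (E F : Set (Fin n → X)) :
    iidProb p (E ∪ F) ≤ iidProb p E + iidProb p F := by
  unfold iidProb
  rw [← iidExp_add]
  refine iidExp_mono p fun x => ?_
  by_cases hE : x ∈ E <;> by_cases hF : x ∈ F <;> simp [hE, hF]

lemma iidProb_compl (E : Set (Fin n → X)) : iidProb p E + iidProb p Eᶜ = 1 := by
  unfold iidProb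
  rw [← iidExp_add]
  refine Eq.trans (congrArg _ ?_) (iidExp_const p 1)
  funext x
  by_cases hE : x ∈ E <;> simp [hE]

/-- Reduces an arbitrary, possibly uncountable, family of events to finite ones: the probability is
a supremum over finite sets of samples, and each bad sample needs only one witnessing index. -/
lemma iidProb_exists_le_of_finset {ι : Type*} (J : Set ι) (E : ι → Set (Fin n → X)) {c : ℝ≥0∞}
    (h : ∀ J' : Finset ι, (J' : Set ι) ⊆ J → iidProb p {x | ∃ j ∈ J', x ∈ E j} ≤ c) :
    iidProb p {x | ∃ j ∈ J, x ∈ E j} ≤ c := by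
  classical
  by_cases hJ : Nonempty ι
  swap
  · refine le_trans (iidProb_mono p ?_) (h ∅ (by simp))
    rintro x ⟨j, -⟩
    exact (hJ ⟨j⟩).elim
  choose! f hf using fun x (hx : ∃ j ∈ J, x ∈ E j) => hx
  rw [iidProb, iidExp, ENNReal.tsum_eq_iSup_sum]
  refine iSup_le fun s => ?_
  let t := s.filter fun x => ∃ j ∈ J, x ∈ E j
  refine le_trans ?_ (h (t.image f) ?_)
  · refine le_trans (Finset.sum_le_sum fun x hx => ?_) (ENNReal.sum_le_tsum s)
    by_cases hxE : ∃ j ∈ J, x ∈ E j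
    · have : ∃ j ∈ t.image f, x ∈ E j :=
        ⟨f x, Finset.mem_image_of_mem f (Finset.mem_filter.2 ⟨hx, hxE⟩), (hf x hxE).2⟩
      rw [Set.indicator_of_mem (by exact hxE), Set.indicator_of_mem (by exact this)]
    · rw [Set.indicator_of_notMem (by exact hxE)]
      simp
  · intro j hj
    obtain ⟨x, hx, rfl⟩ := Finset.mem_image.1 (Finset.mem_coe.1 hj)
    exact (hf x (Finset.mem_filter.1 hx).2).1

/-- The submartingale inequality behind Doob's argument. The weight `h` sees points only through
`S`, that is, it cannot tell points outside `S` apart; so `f` can be traded for `g` one coordinate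
at a time, using only their integrals off `S`. -/
lemma iidExp_mul_prod_le {S : Set X} {f g : X → ℝ≥0∞} (hfg : ∀ y ∈ S, f y = g y)
    (hc : ∑' y, p y * Sᶜ.indicator f y ≤ ∑' y, p y * Sᶜ.indicator g y)
    (h : (Fin n → X) → ℝ≥0∞)
    (hh : ∀ x x', (∀ i, x i = x' i ∨ x i ∉ S ∧ x' i ∉ S) → h x = h x') :
    iidExp p (fun x => h x * ∏ i, f (x i)) ≤ iidExp p (fun x => h x * ∏ i, g (x i)) := by
  have one (H : X → ℝ≥0∞) (hH : ∀ y y', y ∉ S → y' ∉ S → H y = H y') :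
      ∑' y, p y * (f y * H y) ≤ ∑' y, p y * (g y * H y) := by
    have split (k : X → ℝ≥0∞) : ∑' y, p y * (k y * H y) =
        ∑' y, p y * (S.indicator k y * H y) + ∑' y, p y * (Sᶜ.indicator k y * H y) := by
      rw [← ENNReal.tsum_add]
      refine tsum_congr fun y => ?_
      by_cases hy : y ∈ S <;> simp [hy]
    rw [split f, split g]
    have hS : S.indicator f = S.indicator g := Set.indicator_congr hfg
    rw [hS]
    gcongr 1
    by_cases hne : ∃ y₀, y₀ ∉ S
    · obtain ⟨y₀, hy₀⟩ := hne
      have hK (k : X → ℝ≥0∞) : ∑' y, p y * (Sᶜ.indicator k y * H y) =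
          (∑' y, p y * Sᶜ.indicator k y) * H y₀ := by
        rw [← ENNReal.tsum_mul_right]
        refine tsum_congr fun y => ?_
        by_cases hy : y ∈ S
        · simp [hy]
        · rw [hH y y₀ hy hy₀, mul_assoc]
      rw [hK, hK]
      gcongr
    · push Not at hne
      have : Sᶜ = ∅ := by ext y; simp [hne y]
      simp [this]
  induction n with
  | zero => simp [iidExp_zero]
  | succ n ih =>
    have expand (k : X → ℝ≥0∞) (y : X) :
        iidExp p (fun x : Fin n → X => h (Fin.cons y x) *
          ∏ i, k ((Fin.cons y x : Fin (n + 1) → X) i)) =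
        k y * iidExp p (fun x : Fin n → X => h (Fin.cons y x) * ∏ i, k (x i)) := by
      rw [← iidExp_const_mul]
      congr 1
      funext x
      rw [Fin.prod_univ_succ]
      simp only [Fin.cons_zero, Fin.cons_succ]
      ring
    rw [iidExp_succ, iidExp_succ]
    simp only [expand]
    refine le_trans (ENNReal.tsum_le_tsum fun y => ?_) (one (fun y => iidExp p
      (fun x : Fin n → X => h (Fin.cons y x) * ∏ i, g (x i))) fun y y' hy hy' => ?_)
    · gcongr
      refine ih (fun x => h (Fin.cons y x)) fun x x' hx => hh _ _ fun i => ?_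
      refine Fin.cases (by simp) (fun i => ?_) i
      simpa using hx i
    · refine congrArg _ (funext fun x => ?_)
      rw [hh (Fin.cons y x) (Fin.cons y' x) fun i => ?_]
      refine Fin.cases (by simp [hy, hy']) (fun i => ?_) i
      simp

lemma toOuterMeasure_union {S T : Set X} (h : Disjoint S T) :
    p.toOuterMeasure (S ∪ T) = p.toOuterMeasure S + p.toOuterMeasure T := by
  simp only [PMF.toOuterMeasure_apply, ← ENNReal.tsum_add, Set.indicator_union_of_disjoint h]

lemma toOuterMeasure_eq_ofReal (S : Set X) :
    p.toOuterMeasure S = ENNReal.ofReal (populationValue S p) :=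
  (ENNReal.ofReal_toReal (toOuterMeasure_ne_top p S)).symm

lemma populationValue_compl (S : Set X) : populationValue Sᶜ p = 1 - populationValue S p := by
  have h := toOuterMeasure_union p (disjoint_compl_right (a := S))
  have h1 : p.toOuterMeasure (S ∪ Sᶜ) = 1 := by
    rw [PMF.toOuterMeasure_apply_eq_one_iff]; simp
  rw [h1] at h
  have := congrArg ENNReal.toReal h
  rw [ENNReal.toReal_add (toOuterMeasure_ne_top p _) (toOuterMeasure_ne_top p _),
    ENNReal.toReal_one] at this
  simp only [populationValue]
  linarith

lemma populationValue_diff {S T : Set X} (h : S ⊆ T) :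
    populationValue (T \ S) p = populationValue T p - populationValue S p := by
  have h := toOuterMeasure_union p (Set.disjoint_sdiff_right (s := S) (t := T))
  rw [Set.union_sdiff_cancel ‹_›] at h
  have := congrArg ENNReal.toReal h
  rw [ENNReal.toReal_add (toOuterMeasure_ne_top p _) (toOuterMeasure_ne_top p _)] at this
  simp only [populationValue]
  linarith

lemma populationValue_mono {S T : Set X} (h : S ⊆ T) :
    populationValue S p ≤ populationValue T p := by
  have := populationValue_nonneg (T \ S) p
  rw [populationValue_diff p h] at this
  linarith

open Classical in
/-- The factor `a` on `S` and `b` off `S`. -/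
noncomputable def twoValued (S : Set X) (a b : ℝ≥0∞) (y : X) : ℝ≥0∞ := if y ∈ S then a else b

lemma tsum_indicator_const (S : Set X) (a : ℝ≥0∞) :
    ∑' y, p y * S.indicator (fun _ => a) y = a * p.toOuterMeasure S := by
  rw [PMF.toOuterMeasure_apply, ← ENNReal.tsum_mul_left]
  refine tsum_congr fun y => ?_
  by_cases hy : y ∈ S <;> simp [hy, mul_comm]

lemma tsum_twoValued (S : Set X) (a b : ℝ≥0∞) :
    ∑' y, p y * twoValued S a b y = a * p.toOuterMeasure S + b * p.toOuterMeasure Sᶜ := by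
  rw [← tsum_indicator_const, ← tsum_indicator_const, ← ENNReal.tsum_add]
  refine tsum_congr fun y => ?_
  by_cases hy : y ∈ S <;> simp [hy, twoValued]

/-- Doob's maximal inequality for products of two-valued martingales along a chain. -/
lemma mul_iidProb_exists_le {ι : Type*} [LinearOrder ι] {S : ι → Set X} (hS : Monotone S)
    (a : ℝ≥0∞) (b : ι → ℝ≥0∞) (J : Finset ι) (m : ι) (hJ : ∀ j ∈ J, j ≤ m)
    (hb : ∀ j ∈ J, b j * p.toOuterMeasure (S j)ᶜ ≤
      a * p.toOuterMeasure (S m \ S j) + b m * p.toOuterMeasure (S m)ᶜ) (θ : ℝ≥0∞) :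
    θ * iidProb p {x : Fin n → X | ∃ j ∈ J, θ ≤ ∏ i, twoValued (S j) a (b j) (x i)} ≤
      (a * p.toOuterMeasure (S m) + b m * p.toOuterMeasure (S m)ᶜ) ^ n := by
  classical
  let G : ι → (Fin n → X) → ℝ≥0∞ := fun j x => ∏ i, twoValued (S j) a (b j) (x i)
  -- First crossing at index `j`. These events are disjoint and cover the maximal event, and `A j`
  -- depends on the sample only through `S j`, because the chain is increasing and `G k` for `k ≤ j`
  -- is constant off `S j`.
  let A : ι → Set (Fin n → X) := fun j => {x | θ ≤ G j x ∧ ∀ k ∈ J, k < j → G k x < θ}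
  have step (j : ι) (hj : j ∈ J) : iidExp p (fun x => (A j).indicator 1 x * G j x) ≤
      iidExp p (fun x => (A j).indicator 1 x * G m x) := by
    refine iidExp_mul_prod_le p (S := S j) (fun y hy => ?_) ?_ _ fun x x' hx => ?_
    · simp [twoValued, hy, hS (hJ j hj) hy]
    · have h1 : (S j)ᶜ.indicator (twoValued (S j) a (b j)) = (S j)ᶜ.indicator fun _ => b j := by
        refine Set.indicator_congr fun y hy => ?_
        rw [twoValued, if_neg hy]
      have h2 : ∑' y, p y * (S j)ᶜ.indicator (twoValued (S m) a (b m)) y =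
          ∑' y, p y * (S m \ S j).indicator (fun _ => a) y +
            ∑' y, p y * (S m)ᶜ.indicator (fun _ => b m) y := by
        rw [← ENNReal.tsum_add]
        refine tsum_congr fun y => ?_
        by_cases hy : y ∈ S j
        · simp [hy, hS (hJ j hj) hy]
        · by_cases hy' : y ∈ S m <;> simp [hy, hy', twoValued]
      rw [h1, h2, tsum_indicator_const, tsum_indicator_const, tsum_indicator_const]
      exact hb j hj
    · have hGk (k : ι) (hk : k ≤ j) : G k x = G k x' := by
        refine Finset.prod_congr rfl fun i _ => ?_
        rcases hx i with h | ⟨h, h'⟩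
        · rw [h]
        · simp [twoValued, mt (fun z => hS hk z) h, mt (fun z => hS hk z) h']
      have : x ∈ A j ↔ x' ∈ A j := by
        change (_ ≤ _ ∧ _) ↔ (_ ≤ _ ∧ _)
        rw [hGk j le_rfl]
        refine and_congr_right fun _ => forall₂_congr fun k _ => forall_congr' fun hk => ?_
        rw [hGk k hk.le]
      simp [Set.indicator_apply, this]
  calc θ * iidProb p {x : Fin n → X | ∃ j ∈ J, θ ≤ G j x}
      ≤ iidExp p (fun x => ∑ j ∈ J, (A j).indicator 1 x * G j x) := by
        rw [iidProb, ← iidExp_const_mul]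
        refine iidExp_mono p fun x => ?_
        by_cases hx : ∃ j ∈ J, θ ≤ G j x
        · obtain ⟨j, hj, hxA⟩ : ∃ j ∈ J, x ∈ A j := by
            have hne : (J.filter fun j => θ ≤ G j x).Nonempty :=
              hx.imp fun j hj => Finset.mem_filter.2 hj
            obtain ⟨j, hj, hmin⟩ := Finset.exists_min_image _ id hne
            obtain ⟨hjJ, hθ⟩ := Finset.mem_filter.1 hj
            refine ⟨j, hjJ, hθ, fun k hk hkj => ?_⟩
            by_contra hcon
            exact absurd (hmin k (Finset.mem_filter.2 ⟨hk, not_lt.1 hcon⟩)) (not_le.2 hkj)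
          refine le_trans ?_ (Finset.single_le_sum (f := fun j => (A j).indicator 1 x * G j x)
            (fun _ _ => zero_le) hj)
          rw [Set.indicator_of_mem (by exact hx), Set.indicator_of_mem hxA]
          rw [Pi.one_apply, mul_one, one_mul]
          exact hxA.1
        · rw [Set.indicator_of_notMem (by exact hx)]
          simp
    _ = ∑ j ∈ J, iidExp p (fun x => (A j).indicator 1 x * G j x) := iidExp_finset_sum _ _ _
    _ ≤ ∑ j ∈ J, iidExp p (fun x => (A j).indicator 1 x * G m x) := Finset.sum_le_sum step
    _ = iidExp p (fun x => ∑ j ∈ J, (A j).indicator 1 x * G m x) := (iidExp_finset_sum _ _ _).symm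
    _ ≤ iidExp p (G m) := by
        refine iidExp_mono p fun x => ?_
        rw [← Finset.sum_mul]
        refine mul_le_of_le_one_left zero_le ?_
        by_cases hx : ∃ j ∈ J, x ∈ A j
        · obtain ⟨j, hj, hxj⟩ := hx
          rw [Finset.sum_eq_single j]
          · simp [hxj]
          · intro k hk hkj
            refine Set.indicator_of_notMem (fun hxk => ?_) _
            rcases lt_or_gt_of_ne hkj with h | h
            · exact absurd (hxj.2 k hk h) (not_lt.2 hxk.1)
            · exact absurd (hxk.2 j hj h) (not_lt.2 hxj.1)
          · exact fun h => absurd hj h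
        · rw [Finset.sum_eq_zero]
          · exact zero_le
          · exact fun j hj => Set.indicator_of_notMem (fun h => hx ⟨j, hj, h⟩) _
    _ = _ := by rw [iidExp_prod, tsum_twoValued]

end iidProb

/-- Hoeffding's lemma for a Bernoulli random variable. -/
lemma bernoulli_mgf_le {P : ℝ} (h0 : 0 ≤ P) (h1 : P ≤ 1) (t : ℝ) :
    P * Real.exp (t * (1 - P)) + (1 - P) * Real.exp (-(t * P)) ≤ Real.exp (t ^ 2 / 8) := by
  let μ : MeasureTheory.Measure ℝ := ENNReal.ofReal P • MeasureTheory.Measure.dirac 1 +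
    ENNReal.ofReal (1 - P) • MeasureTheory.Measure.dirac 0
  have : MeasureTheory.IsProbabilityMeasure μ := ⟨by
    simp only [μ, MeasureTheory.Measure.add_apply, MeasureTheory.Measure.smul_apply,
      MeasureTheory.measure_univ, smul_eq_mul, mul_one]
    rw [← ENNReal.ofReal_add h0 (by linarith)]
    simp⟩
  have hint (f : ℝ → ℝ) : ∫ x, f x ∂μ = P * f 1 + (1 - P) * f 0 := by
    rw [MeasureTheory.integral_add_measure, MeasureTheory.integral_smul_measure,
      MeasureTheory.integral_smul_measure, MeasureTheory.integral_dirac,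
      MeasureTheory.integral_dirac, ENNReal.toReal_ofReal h0,
      ENNReal.toReal_ofReal (by linarith)]
    · simp
    · exact (MeasureTheory.integrable_dirac (by simp)).smul_measure (by simp)
    · exact (MeasureTheory.integrable_dirac (by simp)).smul_measure (by simp)
  have hsub := ProbabilityTheory.hasSubgaussianMGF_of_mem_Icc (μ := μ) (X := fun x => x)
    (a := 0) (b := 1) aemeasurable_id (by
      simp only [μ]
      rw [MeasureTheory.ae_iff]
      simp)
  have := hsub.mgf_le t
  rw [ProbabilityTheory.mgf, hint, hint] at this
  convert this using 1
  · congr 2 <;> congr 1 <;> ring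
  · congr 1
    simp
    ring

/-- Jensen's inequality through the tangent to `exp` at `v = -lP/(1-P)`. The weights `R - P` and `1
- R` give the points `l` and `-lR/(1-R)` the mean `v`, so the linear terms cancel. -/
lemma martingale_exp_le {P R l : ℝ} (hPR : P ≤ R) (hR : R < 1) :
    Real.exp (-(l * P / (1 - P))) * (1 - P) ≤
      Real.exp l * (R - P) + Real.exp (-(l * R / (1 - R))) * (1 - R) := by
  have hP1 : 0 < 1 - P := by linarith
  have hR1 : 0 < 1 - R := by linarith
  set v := -(l * P / (1 - P)) with hv
  have tangent (x : ℝ) : Real.exp v * (1 + (x - v)) ≤ Real.exp x := by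
    have := Real.add_one_le_exp (x - v)
    calc Real.exp v * (1 + (x - v)) ≤ Real.exp v * Real.exp (x - v) := by gcongr; linarith
      _ = Real.exp x := by rw [← Real.exp_add]; congr 1; ring
  have h1 := mul_le_mul_of_nonneg_right (tangent l) (sub_nonneg.2 hPR)
  have h2 := mul_le_mul_of_nonneg_right (tangent (-(l * R / (1 - R)))) hR1.le
  refine le_trans (le_of_eq ?_) (add_le_add h1 h2)
  have : (l - v) * (R - P) + (-(l * R / (1 - R)) - v) * (1 - R) = 0 := by
    rw [hv]
    field_simp
    ring
  linear_combination (-Real.exp v) * this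

section maximal

variable {X : Type u} (p : PMF X) {n : ℕ}

/-- Identifies the two-valued product with the exponential of the normalised empirical deviation,
which turns a large deviation into a threshold crossing. -/
lemma prod_twoValued_exp (S : Set X) {P : ℝ} (hP : P < 1) (l : ℝ) (x : Fin n → X) :
    ∏ i, twoValued S (ENNReal.ofReal (Real.exp l))
      (ENNReal.ofReal (Real.exp (-(l * P / (1 - P))))) (x i) =
    ENNReal.ofReal (Real.exp (n * (l * (empiricalValue S x - P) / (1 - P)))) := by
  have hP1 : 1 - P ≠ 0 := by linarith
  have h1 (y : X) : twoValued S (ENNReal.ofReal (Real.exp l))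
      (ENNReal.ofReal (Real.exp (-(l * P / (1 - P))))) y =
      ENNReal.ofReal (Real.exp (l * (S.indicator (fun _ => (1 : ℝ)) y - P) / (1 - P))) := by
    by_cases hy : y ∈ S
    · simp only [twoValued, hy, if_true, Set.indicator_of_mem]
      rw [mul_div_assoc, div_self hP1, mul_one]
    · simp only [twoValued, hy, if_false, not_false_eq_true, Set.indicator_of_notMem]
      congr 2
      ring
  simp only [h1]
  rw [← ENNReal.ofReal_prod_of_nonneg fun i _ => (Real.exp_pos _).le, ← Real.exp_sum]
  congr 2
  rw [← Finset.sum_div, ← Finset.mul_sum, Finset.sum_sub_distrib, empiricalValue]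
  rcases Nat.eq_zero_or_pos n with rfl | hn
  · simp
  · have : (n : ℝ) ≠ 0 := by positivity
    simp only [Finset.sum_const, Finset.card_univ, Fintype.card_fin, nsmul_eq_mul]
    field_simp

lemma iidProb_exists_finset_signed_le {ι : Type*} [LinearOrder ι] {S : ι → Set X}
    (hS : Monotone S) {α lo hi : ℝ} (hα : 0 < α) (hhi : hi < 1) (J : Finset ι)
    (hJlo : ∀ j ∈ J, lo ≤ populationValue (S j) p)
    (hJhi : ∀ j ∈ J, populationValue (S j) p ≤ hi) {s : ℝ} (hs : s ^ 2 = 1) :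
    iidProb p {x : Fin n → X | ∃ j ∈ J,
      α < s * (empiricalValue (S j) x - populationValue (S j) p)} ≤
      ENNReal.ofReal (Real.exp (-(2 * n * α ^ 2 * ((1 - hi) / (1 - lo)) ^ 2))) := by
  rcases J.eq_empty_or_nonempty with rfl | hne
  · refine le_of_eq_of_le ?_ zero_le
    simp [iidProb, iidExp]
  set m := J.max' hne with hm
  have hmJ : m ∈ J := J.max'_mem hne
  set P : ι → ℝ := fun j => populationValue (S j) p with hPdef
  have hlohi : lo ≤ hi := (hJlo m hmJ).trans (hJhi m hmJ)
  have hhi1 : 0 < 1 - hi := by linarith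
  have hlo1 : 0 < 1 - lo := by linarith
  -- The minimiser of the Chernoff exponent `κ² / (8 (1 - hi)²) - κ α / (1 - lo)`. The sign `s = ±1`
  -- selects upper or lower deviations.
  set κ := 4 * α * (1 - hi) ^ 2 / (1 - lo) with hκ
  have hκ0 : 0 < κ := by positivity
  set l := s * κ with hl
  set θ := Real.exp (n * (κ * α / (1 - lo))) with hθ
  have key := mul_iidProb_exists_le p (n := n) hS (ENNReal.ofReal (Real.exp l))
    (fun j => ENNReal.ofReal (Real.exp (-(l * P j / (1 - P j))))) J m
    (fun j hj => J.le_max' j hj) (fun j hj => ?_) (ENNReal.ofReal θ)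
  swap
  · have hjm : S j ⊆ S m := hS (J.le_max' j hj)
    have h1 := hJhi m hmJ
    have h2 : P j ≤ P m := populationValue_mono p hjm
    have h3 : P m < 1 := h1.trans_lt hhi
    simp only [toOuterMeasure_eq_ofReal, populationValue_compl, populationValue_diff p hjm]
    rw [← ENNReal.ofReal_mul (Real.exp_pos _).le, ← ENNReal.ofReal_mul (Real.exp_pos _).le,
      ← ENNReal.ofReal_mul (Real.exp_pos _).le, ← ENNReal.ofReal_add
        (mul_nonneg (Real.exp_pos _).le (sub_nonneg.2 h2))
        (mul_nonneg (Real.exp_pos _).le (sub_nonneg.2 h3.le))]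
    exact ENNReal.ofReal_le_ofReal (martingale_exp_le h2 h3)
  have hsub : {x : Fin n → X | ∃ j ∈ J, α < s * (empiricalValue (S j) x - P j)} ⊆
      {x : Fin n → X | ∃ j ∈ J, ENNReal.ofReal θ ≤ ∏ i, twoValued (S j)
        (ENNReal.ofReal (Real.exp l)) (ENNReal.ofReal (Real.exp (-(l * P j / (1 - P j)))))
        (x i)} := by
    rintro x ⟨j, hj, hx⟩
    refine ⟨j, hj, ?_⟩
    have h1 : P j < 1 := (hJhi j hj).trans_lt hhi
    have h2 : 0 < 1 - P j := by linarith
    rw [prod_twoValued_exp _ h1]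
    refine ENNReal.ofReal_le_ofReal (Real.exp_le_exp.2 ?_)
    refine mul_le_mul_of_nonneg_left ?_ (Nat.cast_nonneg n)
    have h3 : lo ≤ P j := hJlo j hj
    calc κ * α / (1 - lo) ≤ κ * α / (1 - P j) := by gcongr
      _ ≤ κ * (s * (empiricalValue (S j) x - P j)) / (1 - P j) := by gcongr
      _ = l * (empiricalValue (S j) x - P j) / (1 - P j) := by rw [hl]; ring
  have hm1 : P m < 1 := (hJhi m hmJ).trans_lt hhi
  have hm2 : 0 < 1 - P m := by linarith
  have hm0 : 0 ≤ P m := populationValue_nonneg _ _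
  have hmgf : (ENNReal.ofReal (Real.exp l) * p.toOuterMeasure (S m) +
      ENNReal.ofReal (Real.exp (-(l * P m / (1 - P m)))) * p.toOuterMeasure (S m)ᶜ) ≤
      ENNReal.ofReal (Real.exp (κ ^ 2 / (1 - hi) ^ 2 / 8)) := by
    simp only [toOuterMeasure_eq_ofReal, populationValue_compl]
    rw [← ENNReal.ofReal_mul (Real.exp_pos _).le, ← ENNReal.ofReal_mul (Real.exp_pos _).le,
      ← ENNReal.ofReal_add (mul_nonneg (Real.exp_pos _).le hm0)
        (mul_nonneg (Real.exp_pos _).le hm2.le)]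
    refine ENNReal.ofReal_le_ofReal ?_
    have h := bernoulli_mgf_le hm0 hm1.le (l / (1 - P m))
    calc _ = P m * Real.exp (l / (1 - P m) * (1 - P m)) +
            (1 - P m) * Real.exp (-(l / (1 - P m) * P m)) := by
          rw [div_mul_cancel₀ _ hm2.ne', div_mul_eq_mul_div]
          ring
      _ ≤ _ := h
      _ ≤ _ := by
          refine Real.exp_le_exp.2 ?_
          rw [div_pow, hl, mul_pow, hs, one_mul]
          have : 1 - hi ≤ 1 - P m := by linarith [hJhi m hmJ]
          gcongr
  have hθ0 : ENNReal.ofReal θ ≠ 0 := by simp [hθ, Real.exp_pos]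
  calc _ ≤ iidProb p {x : Fin n → X | ∃ j ∈ J, ENNReal.ofReal θ ≤ ∏ i, twoValued (S j)
        (ENNReal.ofReal (Real.exp l)) (ENNReal.ofReal (Real.exp (-(l * P j / (1 - P j)))))
        (x i)} := iidProb_mono p hsub
    _ ≤ (ENNReal.ofReal (Real.exp (κ ^ 2 / (1 - hi) ^ 2 / 8))) ^ n / ENNReal.ofReal θ := by
        rw [ENNReal.le_div_iff_mul_le (Or.inl hθ0) (Or.inl ENNReal.ofReal_ne_top), mul_comm]
        exact key.trans (by gcongr)
    _ = _ := by
        rw [← ENNReal.ofReal_pow (Real.exp_pos _).le, ← ENNReal.ofReal_div_of_pos (Real.exp_pos _),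
          ← Real.exp_nat_mul, ← Real.exp_sub]
        congr 2
        rw [hκ]
        field_simp
        ring

lemma iidProb_exists_finset_le {ι : Type*} [LinearOrder ι] {S : ι → Set X}
    (hS : Monotone S) {α lo hi : ℝ} (hα : 0 < α) (hhi : hi < 1) (J : Finset ι)
    (hJlo : ∀ j ∈ J, lo ≤ populationValue (S j) p)
    (hJhi : ∀ j ∈ J, populationValue (S j) p ≤ hi) :
    iidProb p {x : Fin n → X | ∃ j ∈ J,
      α < |empiricalValue (S j) x - populationValue (S j) p|} ≤
      2 * ENNReal.ofReal (Real.exp (-(2 * n * α ^ 2 * ((1 - hi) / (1 - lo)) ^ 2))) := by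
  rw [two_mul]
  refine le_trans ((iidProb_mono p ?_).trans (iidProb_union_le p _ _)) (add_le_add
    (iidProb_exists_finset_signed_le p hS hα hhi J hJlo hJhi (s := 1) (by norm_num))
    (iidProb_exists_finset_signed_le p hS hα hhi J hJlo hJhi (s := -1) (by norm_num)))
  rintro x ⟨j, hj, hx⟩
  rcases lt_abs.1 hx with h | h
  · exact Or.inl ⟨j, hj, by linarith⟩
  · exact Or.inr ⟨j, hj, by linarith⟩

lemma iidProb_exists_le_of_le_half {ι : Type*} [LinearOrder ι] {S : ι → Set X}
    (hS : Monotone S) {α : ℝ} (hα : 0 < α) (J : Set ι)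
    (hJ : ∀ j ∈ J, populationValue (S j) p ≤ 1 / 2) :
    iidProb p {x : Fin n → X | ∃ j ∈ J,
      α < |empiricalValue (S j) x - populationValue (S j) p|} ≤
      4 * ENNReal.ofReal (Real.exp (-(n * α ^ 2))) := by
  classical
  refine iidProb_exists_le_of_finset p J
    (fun j => {x | α < |empiricalValue (S j) x - populationValue (S j) p|}) fun J' hJ' => ?_
  have hsq : √(1 / 2 : ℝ) ^ 2 = 1 / 2 := Real.sq_sqrt (by norm_num)
  have hpos : 0 < √(1 / 2 : ℝ) := Real.sqrt_pos.2 (by norm_num)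
  -- Splitting `[0, 1/2]` at `c` makes the loss ratio `(1 - hi) / (1 - lo)` equal to `√(1/2)` on
  -- both pieces, so both exponents become `nα²`.
  set c := 1 - √(1 / 2 : ℝ) with hc
  have h1 := iidProb_exists_finset_le p (n := n) hS hα (lo := 0) (hi := c) (by linarith)
    (J'.filter fun j => populationValue (S j) p ≤ c) (fun j _ => populationValue_nonneg _ _)
    (fun j hj => (Finset.mem_filter.1 hj).2)
  have h2 := iidProb_exists_finset_le p (n := n) hS hα (lo := c) (hi := 1 / 2) (by norm_num)
    (J'.filter fun j => ¬ populationValue (S j) p ≤ c)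
    (fun j hj => (not_le.1 (Finset.mem_filter.1 hj).2).le)
    (fun j hj => hJ j (hJ' (Finset.mem_filter.1 hj).1))
  have e1 : 2 * (n : ℝ) * α ^ 2 * ((1 - c) / (1 - 0)) ^ 2 = n * α ^ 2 := by
    have : ((1 - c) / (1 - 0)) ^ 2 = 1 / 2 := by rw [← hsq]; simp [hc]
    rw [this]; ring
  have e2 : 2 * (n : ℝ) * α ^ 2 * ((1 - 1 / 2) / (1 - c)) ^ 2 = n * α ^ 2 := by
    have : ((1 - 1 / 2) / (1 - c)) ^ 2 = 1 / 2 := by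
      have : 1 - c = √(1 / 2 : ℝ) := by rw [hc]; ring
      rw [this, div_pow, hsq]; norm_num
    rw [this]; ring
  rw [e1] at h1
  rw [e2] at h2
  refine le_trans ((iidProb_mono p ?_).trans (iidProb_union_le p _ _))
    ((add_le_add h1 h2).trans_eq ?_)
  · rintro x ⟨j, hj, hx⟩
    by_cases hjc : populationValue (S j) p ≤ c
    · exact Or.inl ⟨j, Finset.mem_filter.2 ⟨hj, hjc⟩, hx⟩
    · exact Or.inr ⟨j, Finset.mem_filter.2 ⟨hj, hjc⟩, hx⟩
  · rw [← add_mul]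
    norm_num

lemma empiricalValue_compl [NeZero n] (S : Set X) (x : Fin n → X) :
    empiricalValue Sᶜ x = 1 - empiricalValue S x := by
  rw [← populationValue_empiricalPMF, ← populationValue_empiricalPMF, populationValue_compl]

/-- A uniform deviation bound of Dvoretzky–Kiefer–Wolfowitz type for a chain of queries. -/
lemma iidProb_chain_le {ι : Type*} [LinearOrder ι] {S : ι → Set X}
    (hS : Monotone S) {α : ℝ} (hα : 0 < α) :
    iidProb p {x : Fin n → X | ∃ j,
      α < |empiricalValue (S j) x - populationValue (S j) p|} ≤
      8 * ENNReal.ofReal (Real.exp (-(n * α ^ 2))) := by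
  rcases Nat.eq_zero_or_pos n with rfl | hn
  · refine (iidProb_le_one p _).trans ?_
    norm_num
  have : NeZero n := ⟨hn.ne'⟩
  have h1 := iidProb_exists_le_of_le_half p (n := n) hS hα
    {j | populationValue (S j) p ≤ 1 / 2} (fun j hj => hj)
  -- Queries of probability above `1/2` are treated through their complements, a chain for the
  -- reversed order with the same deviations. This keeps `1 - P` away from `0`.
  have hS' : Monotone fun j : ιᵒᵈ => (S (OrderDual.ofDual j))ᶜ :=
    fun j k hjk => Set.compl_subset_compl.2 (hS hjk)
  have h2 := iidProb_exists_le_of_le_half p (n := n) hS' hα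
    {j | 1 / 2 < populationValue (S (OrderDual.ofDual j)) p}
    (fun j hj => by
      rw [populationValue_compl]
      have : 1 / 2 < populationValue (S (OrderDual.ofDual j)) p := hj
      linarith)
  refine le_trans ((iidProb_mono p ?_).trans (iidProb_union_le p _ _))
    ((add_le_add h1 h2).trans_eq ?_)
  · rintro x ⟨j, hx⟩
    by_cases hj : populationValue (S j) p ≤ 1 / 2
    · exact Or.inl ⟨j, hj, hx⟩
    · refine Or.inr ⟨OrderDual.toDual j, not_le.1 hj, ?_⟩
      simp only [OrderDual.ofDual_toDual, empiricalValue_compl, populationValue_compl]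
      rwa [sub_sub_sub_cancel_left, abs_sub_comm]
  · rw [← add_mul]
    norm_num

end maximal

/-! ### Uniform convergence for thresholds -/

lemma iidProb_thresh_le {X : Type u} [LinearOrder X] (p : PMF X) {n : ℕ} {α β : ℝ} (hα : 0 < α)
    (hβ : 0 < β) (hβ2 : β ≤ 1 / 2) (hn : 2 * Real.log (2 / β) / α ^ 2 ≤ (n : ℝ)) :
    iidProb p {x : Fin n → X | ∃ q ∈ thresh X, α < |empiricalValue q x - populationValue q p|} ≤
      ENNReal.ofReal β := by
  refine le_trans (iidProb_mono p ?_)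
    ((iidProb_chain_le p (S := fun t : X => Set.Iic t) (fun _ _ h => Set.Iic_subset_Iic.2 h)
      hα).trans ?_)
  · rintro x ⟨_, ⟨t, rfl⟩, h⟩
    exact ⟨t, h⟩
  · rw [div_le_iff₀ (by positivity)] at hn
    -- The bound `8 (β/2)² = 2β²` is at most `β` exactly because `β ≤ 1/2`.
    have h1 : Real.exp (-(n * α ^ 2)) ≤ (β / 2) ^ 2 := by
      calc Real.exp (-(n * α ^ 2)) ≤ Real.exp (-(2 * Real.log (2 / β))) :=
            Real.exp_le_exp.2 (neg_le_neg hn)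
        _ = (β / 2) ^ 2 := by
            rw [← mul_neg, ← Real.log_inv, inv_div, mul_comm, Real.exp_mul,
              Real.exp_log (by positivity)]
            norm_cast
    have h8 : (8 : ℝ≥0∞) = ENNReal.ofReal 8 := by norm_num
    rw [h8, ← ENNReal.ofReal_mul (by norm_num)]
    refine ENNReal.ofReal_le_ofReal ?_
    nlinarith

/-! ### Symmetrization -/

section symmetrization

variable {X : Type u} (p : PMF X) {n : ℕ}

/-- A single query is a one-element chain, so the chain bound applies with `α/2`; the constant `12`
yields `8 exp(-3) ≤ 1/2`. -/
lemma iidProb_deviation_le_half {α : ℝ} (hα : 0 < α) (hn : 12 ≤ n * α ^ 2) (q : Set X) :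
    iidProb p {x : Fin n → X | α / 2 < |empiricalValue q x - populationValue q p|} ≤ 1 / 2 := by
  refine le_trans (iidProb_mono p ?_)
    ((iidProb_chain_le p (n := n) (S := fun _ : Unit => q) (fun _ _ _ => le_rfl)
      (half_pos hα)).trans ?_)
  · exact fun x h => ⟨(), h⟩
  · have h1 : Real.exp (-(n * (α / 2) ^ 2)) ≤ 1 / 16 := by
      have h2 : Real.exp (-(n * (α / 2) ^ 2)) ≤ Real.exp (-3) := Real.exp_le_exp.2 (by linarith)
      have h3 : (16 : ℝ) ≤ Real.exp 3 := by
        have h4 := Real.exp_one_gt_d9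
        have h5 : Real.exp 3 = Real.exp 1 ^ 3 := by rw [← Real.exp_nat_mul]; norm_num
        rw [h5]
        calc (16 : ℝ) ≤ 2.7 ^ 3 := by norm_num
          _ ≤ Real.exp 1 ^ 3 := by gcongr; linarith
      rw [Real.exp_neg 3] at h2
      refine h2.trans ?_
      rw [one_div]
      gcongr
    have h8 : (8 : ℝ≥0∞) = ENNReal.ofReal 8 := by norm_num
    have h12 : (1 / 2 : ℝ≥0∞) = ENNReal.ofReal (1 / 2) := by
      rw [ENNReal.ofReal_div_of_pos (by norm_num)]; norm_num
    rw [h8, h12, ← ENNReal.ofReal_mul (by norm_num)]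
    refine ENNReal.ofReal_le_ofReal ?_
    linarith

/-- Ghost sample: fix a query that is bad on `x`. With probability at least `1/2` an independent
sample estimates it within `α/2`, and then the two samples disagree by more than `α/2`. -/
lemma iidProb_le_two_mul_ghost (Q : Set (Set X)) {α : ℝ} (hα : 0 < α) (hn : 12 ≤ n * α ^ 2) :
    iidProb p {x : Fin n → X | ∃ q ∈ Q, α < |empiricalValue q x - populationValue q p|} ≤
      2 * iidExp p (fun x : Fin n → X => iidProb p {x' : Fin n → X | ∃ q ∈ Q,
        α / 2 < |empiricalValue q x - empiricalValue q x'|}) := by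
  rw [← iidExp_const_mul]
  refine iidExp_mono p fun x => ?_
  by_cases hx : ∃ q ∈ Q, α < |empiricalValue q x - populationValue q p|
  swap
  · rw [Set.indicator_of_notMem (by exact hx)]
    exact zero_le
  rw [Set.indicator_of_mem (by exact hx)]
  obtain ⟨q, hq, hxq⟩ := hx
  set E : Set (Fin n → X) := {x' | α / 2 < |empiricalValue q x' - populationValue q p|}
  have h1 : iidProb p E ≤ 1 / 2 := iidProb_deviation_le_half p hα hn q
  have h2 : iidProb p Eᶜ ≤ iidProb p {x' : Fin n → X | ∃ q ∈ Q,
      α / 2 < |empiricalValue q x - empiricalValue q x'|} := by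
    refine iidProb_mono p fun x' hx' => ⟨q, hq, ?_⟩
    have h3 : |empiricalValue q x' - populationValue q p| ≤ α / 2 := not_lt.1 hx'
    have := abs_sub_le (empiricalValue q x) (empiricalValue q x') (populationValue q p)
    linarith
  have h3 := iidProb_compl p E
  have h4 : (1 / 2 : ℝ≥0∞) ≤ iidProb p Eᶜ := by
    have h5 : (1 : ℝ≥0∞) ≤ 1 / 2 + iidProb p Eᶜ := by
      exact h3.symm.trans_le (add_le_add_left h1 _)
    exact (ENNReal.add_le_add_iff_left (a := 1 / 2) (by simp)).1
      ((ENNReal.add_halves 1).trans_le h5)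
  calc (1 : ℝ≥0∞) = 2 * (1 / 2) := by
        rw [one_div, ENNReal.mul_inv_cancel (by norm_num) (by norm_num)]
    _ ≤ _ := by gcongr; exact h4.trans h2

/-- The product of `p` with itself. -/
noncomputable def sqPMF : PMF (X × X) :=
  ⟨fun z => p z.1 * p z.2, by
    rw [Summable.hasSum_iff ENNReal.summable, ENNReal.tsum_prod']
    simp [ENNReal.tsum_mul_left]⟩

lemma sqPMF_apply (z : X × X) : sqPMF p z = p z.1 * p z.2 := rfl

lemma iidExp_iidExp (ψ : (Fin n → X) → (Fin n → X) → ℝ≥0∞) :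
    iidExp p (fun x => iidExp p (fun x' => ψ x x')) =
      iidExp (sqPMF p) (fun z : Fin n → X × X => ψ (fun i => (z i).1) (fun i => (z i).2)) := by
  unfold iidExp
  rw [← (Equiv.arrowProdEquivProdArrow (Fin n) (fun _ => X) (fun _ => X)).symm.tsum_eq,
    ENNReal.tsum_prod']
  simp only [← ENNReal.tsum_mul_left, sqPMF_apply, Equiv.arrowProdEquivProdArrow,
    Equiv.coe_fn_symm_mk, Finset.prod_mul_distrib, mul_assoc]

lemma iidExp_comp_perm (e : Fin n → Equiv.Perm X) (he : ∀ i y, p (e i y) = p y)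
    (φ : (Fin n → X) → ℝ≥0∞) : iidExp p (fun x => φ fun i => e i (x i)) = iidExp p φ := by
  unfold iidExp
  rw [← (Equiv.piCongrRight e).tsum_eq fun x => (∏ i, p (x i)) * φ x]
  refine tsum_congr fun x => ?_
  simp only [Equiv.piCongrRight_apply, Pi.map_apply, he]
  rfl

/-- Exchange the components where `σ` is true. -/
def swapPairs (σ : Fin n → Bool) (z : Fin n → X × X) (i : Fin n) : X × X :=
  bif σ i then (z i).swap else z i

lemma iidExp_swapPairs (σ : Fin n → Bool) (φ : (Fin n → X × X) → ℝ≥0∞) :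
    iidExp (sqPMF p) (fun z => φ (swapPairs σ z)) = iidExp (sqPMF p) φ := by
  rw [← iidExp_comp_perm (sqPMF p)
    (fun i => bif σ i then Equiv.prodComm X X else Equiv.refl _) ?_ φ]
  · refine congrArg _ (funext fun z => congrArg φ (funext fun i => ?_))
    cases h : σ i <;> simp [swapPairs, h]
  · intro i y
    cases h : σ i <;> simp [sqPMF_apply, mul_comm]

-- Exchanging the two members of any pairs preserves the law of the double sample. Averaging over
-- all `2^n` swaps therefore reduces the probability to a count of swaps for each fixed `z`.
open Classical in
lemma iidProb_sqPMF_le (E : Set (Fin n → X × X)) {c : ℝ}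
    (h : ∀ z, ((Finset.univ.filter fun σ : Fin n → Bool => swapPairs σ z ∈ E).card : ℝ) ≤
      2 ^ n * c) :
    iidProb (sqPMF p) E ≤ ENNReal.ofReal c := by
  have h2 : (2 : ℝ≥0∞) ^ n * iidProb (sqPMF p) E ≤ 2 ^ n * ENNReal.ofReal c := by
    calc (2 : ℝ≥0∞) ^ n * iidProb (sqPMF p) E
        = ∑ σ : Fin n → Bool, iidExp (sqPMF p) (fun z => E.indicator 1 (swapPairs σ z)) := by
          simp only [iidExp_swapPairs]
          simp [iidProb]
          rfl
      _ = iidExp (sqPMF p) (fun z => ∑ σ : Fin n → Bool, E.indicator 1 (swapPairs σ z)) :=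
          (iidExp_finset_sum _ _ _).symm
      _ ≤ iidExp (sqPMF p) (fun _ => ENNReal.ofReal (2 ^ n * c)) := by
          refine iidExp_mono _ fun z => ?_
          simp only [Set.indicator_apply, Pi.one_apply, Finset.sum_boole]
          rw [← ENNReal.ofReal_natCast]
          exact ENNReal.ofReal_le_ofReal (h z)
      _ = _ := by
          rw [iidExp_const, ENNReal.ofReal_mul (by positivity), ENNReal.ofReal_pow (by norm_num)]
          norm_num
  exact (ENNReal.mul_le_mul_iff_right (by simp) (by simp)).1 h2

end symmetrization

/-! ### Random signs -/

/-- The sign attached to a Boolean. -/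
def boolSign (b : Bool) : ℝ := bif b then -1 else 1

lemma card_sign_sum_gt_le {n : ℕ} (hn : 0 < n) {v : Fin n → ℝ} (hv : ∀ i, |v i| ≤ 1) {t : ℝ}
    (ht : 0 ≤ t) :
    ((Finset.univ.filter fun σ : Fin n → Bool => t < ∑ i, boolSign (σ i) * v i).card : ℝ) ≤
      2 ^ n * Real.exp (-(t ^ 2 / (2 * n))) := by
  have hn' : (0 : ℝ) < n := by exact_mod_cast hn
  -- The minimiser of the Chernoff exponent `n l² / 2 - l t`.
  set l := t / n with hl
  have hl0 : 0 ≤ l := by positivity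
  have h1 : ((Finset.univ.filter fun σ : Fin n → Bool => t < ∑ i, boolSign (σ i) * v i).card : ℝ)
      * Real.exp (l * t) ≤ 2 ^ n * Real.exp (n * (l ^ 2 / 2)) := by
    calc _ = ∑ σ ∈ Finset.univ.filter fun σ : Fin n → Bool => t < ∑ i, boolSign (σ i) * v i,
            Real.exp (l * t) := by simp
      _ ≤ ∑ σ ∈ Finset.univ.filter fun σ : Fin n → Bool => t < ∑ i, boolSign (σ i) * v i,
            Real.exp (l * ∑ i, boolSign (σ i) * v i) := by
          refine Finset.sum_le_sum fun σ hσ => Real.exp_le_exp.2 ?_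
          exact mul_le_mul_of_nonneg_left (Finset.mem_filter.1 hσ).2.le hl0
      _ ≤ ∑ σ : Fin n → Bool, Real.exp (l * ∑ i, boolSign (σ i) * v i) :=
          Finset.sum_le_sum_of_subset_of_nonneg (Finset.filter_subset _ _)
            fun _ _ _ => (Real.exp_pos _).le
      _ = ∏ i, ∑ b : Bool, Real.exp (l * (boolSign b * v i)) := by
          rw [Finset.prod_univ_sum, Fintype.piFinset_univ]
          simp only [Finset.mul_sum, Real.exp_sum]
      _ = ∏ i, (2 * Real.cosh (l * v i)) := by
          refine Finset.prod_congr rfl fun i _ => ?_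
          rw [Real.cosh_eq]
          simp [boolSign]
          ring
      _ ≤ ∏ _i : Fin n, (2 * Real.exp (l ^ 2 / 2)) := by
          refine Finset.prod_le_prod (fun i _ => by positivity) fun i _ => ?_
          have h2 : (l * v i) ^ 2 ≤ l ^ 2 := by
            rw [mul_pow, ← sq_abs (v i)]
            exact mul_le_of_le_one_right (sq_nonneg l) (pow_le_one₀ (abs_nonneg _) (hv i))
          have := (Real.cosh_le_exp_half_sq (l * v i)).trans
            (Real.exp_le_exp.2 (div_le_div_of_nonneg_right h2 (by norm_num : (0 : ℝ) ≤ 2)))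
          linarith
      _ = _ := by
          rw [Finset.prod_const, Finset.card_univ, Fintype.card_fin, mul_pow, ← Real.exp_nat_mul]
  rw [← le_div_iff₀ (Real.exp_pos _), mul_div_assoc, ← Real.exp_sub] at h1
  refine h1.trans_eq ?_
  congr 2
  rw [hl]
  field_simp
  ring

lemma card_abs_sign_sum_gt_le {n : ℕ} (hn : 0 < n) {v : Fin n → ℝ} (hv : ∀ i, |v i| ≤ 1) {t : ℝ}
    (ht : 0 ≤ t) :
    ((Finset.univ.filter fun σ : Fin n → Bool => t < |∑ i, boolSign (σ i) * v i|).card : ℝ) ≤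
      2 ^ n * (2 * Real.exp (-(t ^ 2 / (2 * n)))) := by
  classical
  have h1 := card_sign_sum_gt_le hn hv ht
  have h2 := card_sign_sum_gt_le hn (v := fun i => -v i) (fun i => by simpa using hv i) ht
  have h3 : (Finset.univ.filter fun σ : Fin n → Bool => t < |∑ i, boolSign (σ i) * v i|) ⊆
      (Finset.univ.filter fun σ : Fin n → Bool => t < ∑ i, boolSign (σ i) * v i) ∪
      (Finset.univ.filter fun σ : Fin n → Bool => t < ∑ i, boolSign (σ i) * -v i) := by
    intro σ hσ
    simpa [lt_abs] using hσ
  have h4 : ((Finset.univ.filter fun σ : Fin n → Bool =>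
      t < |∑ i, boolSign (σ i) * v i|).card : ℝ) ≤ _ :=
    Nat.cast_le.2 ((Finset.card_le_card h3).trans (Finset.card_union_le _ _))
  push_cast at h4
  linarith

/-! ### Traces of a class of queries -/

section traces

variable {X : Type u} {κ : Type v} [Fintype κ]

open Classical in
/-- The subsets of `κ` that `Q` cuts out through `y`. -/
noncomputable def traces (Q : Set (Set X)) (y : κ → X) : Finset (Finset κ) :=
  Finset.univ.filter fun T => ∃ q ∈ Q, ∀ k, k ∈ T ↔ y k ∈ q

lemma mem_traces {Q : Set (Set X)} {y : κ → X} {T : Finset κ} :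
    T ∈ traces Q y ↔ ∃ q ∈ Q, ∀ k, k ∈ T ↔ y k ∈ q := by
  simp [traces]

/-- The points `y k` may repeat, but not on a shattered index set: cutting out singletons forces `y`
to be injective there, so its image is shattered by `Q` with the same size. -/
lemma vcDim_traces_le [DecidableEq κ] {Q : Set (Set X)} {d : ℕ} (hQ : vcDim Q ≤ d) (y : κ → X) :
    (traces Q y).vcDim ≤ d := by
  classical
  refine Finset.sup_le fun T hT => ?_
  rw [Finset.mem_shatterer] at hT
  have hinj : Set.InjOn y T := by
    intro k hk l hl hkl
    obtain ⟨A, hA, hTA⟩ := hT (t := {k}) (Finset.singleton_subset_iff.2 hk)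
    obtain ⟨q, -, hq⟩ := mem_traces.1 hA
    have hkA : k ∈ A := (Finset.mem_inter.1 (hTA ▸ Finset.mem_singleton_self k : k ∈ T ∩ A)).2
    have hlA : l ∈ A := by rw [hq, ← hkl, ← hq]; exact hkA
    have : l ∈ T ∩ A := Finset.mem_inter.2 ⟨hl, hlA⟩
    rw [hTA, Finset.mem_singleton] at this
    exact this.symm
  have hsh : ShatteredBy Q (T.image y) := by
    intro U hU
    obtain ⟨A, hA, hTA⟩ := hT (Finset.filter_subset (fun k => y k ∈ U) T)
    obtain ⟨q, hqQ, hq⟩ := mem_traces.1 hA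
    refine ⟨q, hqQ, ?_⟩
    have key (k : κ) (hk : k ∈ T) : y k ∈ q ↔ y k ∈ U := by
      have := congrArg (k ∈ ·) hTA
      simpa [hk, hq] using this
    ext x
    constructor
    · rintro ⟨hx, hxq⟩
      obtain ⟨k, hk, rfl⟩ := Finset.mem_image.1 (Finset.mem_coe.1 hx)
      exact (key k hk).1 hxq
    · intro hxU
      have hx := hU hxU
      obtain ⟨k, hk, rfl⟩ := Finset.mem_image.1 (Finset.mem_coe.1 hx)
      exact ⟨hx, (key k hk).2 hxU⟩
  have h1 : (((T.image y).card : ℕ) : ℕ∞) ≤ d :=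
    (le_iSup₂ (f := fun (S : Finset X) (_ : ShatteredBy Q S) => (S.card : ℕ∞)) _ hsh).trans hQ
  rw [Finset.card_image_of_injOn hinj] at h1
  exact_mod_cast h1

/-- For `k ≤ d` the factor `(m/d)^d (d/m)^k` is at least `1`; insert it, extend the sum to all `k ≤
m`, and apply the binomial theorem with `1 + d/m ≤ exp (d/m)`. -/
lemma sum_choose_le {d m : ℕ} (hd : 0 < d) (hdm : d ≤ m) :
    ((∑ k ∈ Finset.Iic d, m.choose k : ℕ) : ℝ) ≤ (m / d * Real.exp 1) ^ d := by
  have hd' : (0 : ℝ) < d := by exact_mod_cast hd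
  have hm' : (0 : ℝ) < m := by exact_mod_cast hd.trans_le hdm
  have hr : (1 : ℝ) ≤ m / d := by
    rw [one_le_div hd']; exact_mod_cast hdm
  calc ((∑ k ∈ Finset.Iic d, m.choose k : ℕ) : ℝ)
      = ∑ k ∈ Finset.Iic d, (m.choose k : ℝ) := by push_cast; rfl
    _ ≤ ∑ k ∈ Finset.Iic d, (m / d : ℝ) ^ d * ((d / m : ℝ) ^ k * m.choose k) := by
        refine Finset.sum_le_sum fun k hk => ?_
        have hk' := Finset.mem_Iic.1 hk
        have h1 : (m / d : ℝ) ^ d * (d / m : ℝ) ^ k = (m / d : ℝ) ^ (d - k) := by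
          rw [pow_sub₀ _ (by positivity) hk', ← inv_pow, inv_div]
        rw [← mul_assoc, h1]
        exact le_mul_of_one_le_left (Nat.cast_nonneg _) (one_le_pow₀ hr)
    _ ≤ ∑ k ∈ Finset.range (m + 1), (m / d : ℝ) ^ d * ((d / m : ℝ) ^ k * m.choose k) := by
        refine Finset.sum_le_sum_of_subset_of_nonneg (fun k hk => ?_) fun _ _ _ => by positivity
        have := Finset.mem_Iic.1 hk
        exact Finset.mem_range.2 (by omega)
    _ = (m / d : ℝ) ^ d * (d / m + 1) ^ m := by
        rw [add_pow, Finset.mul_sum]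
        simp
    _ ≤ (m / d : ℝ) ^ d * (Real.exp (d / m)) ^ m := by
        gcongr
        exact Real.add_one_le_exp _
    _ = _ := by
        rw [← Real.exp_nat_mul, mul_pow, ← Real.exp_nat_mul]
        congr 2
        field_simp

lemma card_traces_le {Q : Set (Set X)} {d : ℕ} (hd : 0 < d) (hQ : vcDim Q ≤ d) (y : κ → X)
    (hκ : d ≤ Fintype.card κ) :
    ((traces Q y).card : ℝ) ≤ (Fintype.card κ / d * Real.exp 1) ^ d := by
  classical
  refine le_trans (Nat.cast_le.2 ?_) (sum_choose_le hd hκ)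
  refine (Finset.card_le_card_shatterer _).trans (Finset.card_shatterer_le_sum_vcDim.trans ?_)
  exact Finset.sum_le_sum_of_subset (Finset.Iic_subset_Iic.2 (vcDim_traces_le hQ y))

end traces

/-! ### Uniform convergence for classes of finite VC dimension -/

lemma empiricalValue_sub_swapPairs {X : Type u} {n : ℕ} (q : Set X) (σ : Fin n → Bool)
    (z : Fin n → X × X) :
    empiricalValue q (fun i => (swapPairs σ z i).1) -
      empiricalValue q (fun i => (swapPairs σ z i).2) =
    (∑ i, boolSign (σ i) * (q.indicator (fun _ => (1 : ℝ)) (z i).1 -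
      q.indicator (fun _ => (1 : ℝ)) (z i).2)) / n := by
  unfold empiricalValue
  rw [← sub_div, ← Finset.sum_sub_distrib]
  congr 1
  refine Finset.sum_congr rfl fun i _ => ?_
  cases h : σ i <;> simp [swapPairs, boolSign, h]

-- For a fixed double sample, a query matters only through its trace on the `2n` points. A union
-- bound over the traces combines Sauer–Shelah with the sign bound at `t = nα/2`.
open Classical in
lemma card_swapPairs_le {X : Type u} {n d : ℕ} (hn : 0 < n) (hd : 0 < d) (hdn : d ≤ 2 * n)
    {Q : Set (Set X)} (hQ : vcDim Q ≤ d) {α : ℝ} (hα : 0 ≤ α) (z : Fin n → X × X) :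
    ((Finset.univ.filter fun σ : Fin n → Bool => ∃ q ∈ Q, α / 2 <
      |empiricalValue q (fun i => (swapPairs σ z i).1) -
        empiricalValue q (fun i => (swapPairs σ z i).2)|).card : ℝ) ≤
      2 ^ n * ((2 * n / d * Real.exp 1) ^ d * (2 * Real.exp (-(n * α ^ 2 / 8)))) := by
  have hn' : (0 : ℝ) < n := by exact_mod_cast hn
  let y : Fin n × Bool → X := fun k => bif k.2 then (z k.1).2 else (z k.1).1
  let v : Finset (Fin n × Bool) → Fin n → ℝ := fun T i =>
    (if (i, false) ∈ T then 1 else 0) - (if (i, true) ∈ T then 1 else 0)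
  have hv (T : Finset (Fin n × Bool)) (i : Fin n) : |v T i| ≤ 1 := by
    simp only [v]
    split_ifs <;> norm_num
  have hsub : (Finset.univ.filter fun σ : Fin n → Bool => ∃ q ∈ Q, α / 2 <
      |empiricalValue q (fun i => (swapPairs σ z i).1) -
        empiricalValue q (fun i => (swapPairs σ z i).2)|) ⊆
      (traces Q y).biUnion fun T => Finset.univ.filter fun σ : Fin n → Bool =>
        n * (α / 2) < |∑ i, boolSign (σ i) * v T i| := by
    intro σ hσ
    obtain ⟨q, hq, h⟩ := (Finset.mem_filter.1 hσ).2
    refine Finset.mem_biUnion.2 ⟨Finset.univ.filter fun k => y k ∈ q,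
      mem_traces.2 ⟨q, hq, fun k => by simp⟩, Finset.mem_filter.2 ⟨Finset.mem_univ _, ?_⟩⟩
    rw [empiricalValue_sub_swapPairs, abs_div, abs_of_pos hn', lt_div_iff₀ hn', mul_comm] at h
    have hvi (i : Fin n) : v (Finset.univ.filter fun k => y k ∈ q) i =
        q.indicator (fun _ => (1 : ℝ)) (z i).1 - q.indicator (fun _ => (1 : ℝ)) (z i).2 := by
      simp [v, y, Set.indicator_apply]
    simp only [hvi]
    exact h
  have hcard := card_traces_le hd hQ y (by simpa [mul_comm] using hdn)
  have e : (n * (α / 2)) ^ 2 / (2 * n) = n * α ^ 2 / 8 := by field_simp; ring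
  calc _ ≤ (∑ T ∈ traces Q y, ((Finset.univ.filter fun σ : Fin n → Bool =>
          n * (α / 2) < |∑ i, boolSign (σ i) * v T i|).card : ℝ)) := by
        exact_mod_cast (Finset.card_le_card hsub).trans Finset.card_biUnion_le
    _ ≤ ∑ T ∈ traces Q y, 2 ^ n * (2 * Real.exp (-(n * α ^ 2 / 8))) := by
        refine Finset.sum_le_sum fun T _ => ?_
        rw [← e]
        exact card_abs_sign_sum_gt_le hn (hv T) (by positivity)
    _ = (traces Q y).card * (2 ^ n * (2 * Real.exp (-(n * α ^ 2 / 8)))) := by simp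
    _ ≤ (2 * n / d * Real.exp 1) ^ d * (2 ^ n * (2 * Real.exp (-(n * α ^ 2 / 8)))) := by
        gcongr
        simpa [mul_comm] using hcard
    _ = _ := by ring

/-- The left side is `4 c^d` with `c = (2n/d) e exp(-s/8)` and `s = nα²/d`. Half of the exponent
absorbs the factor `n/d` via `x exp(-x) ≤ 1/e`; the other half is at most `(αβ/48)^16`, of which
only the square is needed to cancel `1/α²` and reach `c ≤ β/4`. -/
lemma growth_mul_exp_le {n d : ℕ} (hd : 0 < d) {α β : ℝ} (hα : 0 < α) (hα1 : α ≤ 1) (hβ : 0 < β)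
    (hβ1 : β ≤ 1) (hn : 256 * d * Real.log (48 / (α * β)) / α ^ 2 ≤ (n : ℝ)) :
    2 * ((2 * n / d * Real.exp 1) ^ d * (2 * Real.exp (-(n * α ^ 2 / 8)))) ≤ β := by
  have hd' : (0 : ℝ) < d := by exact_mod_cast hd
  set L := Real.log (48 / (α * β)) with hL
  set s : ℝ := n * α ^ 2 / d with hs
  have hsL : 256 * L ≤ s := by
    rw [div_le_iff₀ (by positivity)] at hn
    rw [hs, le_div_iff₀ hd']
    linarith
  set c := 2 * n / d * Real.exp 1 * Real.exp (-(s / 8)) with hc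
  have hc0 : 0 ≤ c := by positivity
  have hpow : (2 * n / d * Real.exp 1) ^ d * Real.exp (-(n * α ^ 2 / 8)) = c ^ d := by
    rw [hc, mul_pow _ (Real.exp (-(s / 8))), ← Real.exp_nat_mul (-(s / 8))]
    congr 2
    rw [hs]
    field_simp
  set w := α * β / 48 with hw
  have hw0 : 0 < w := by positivity
  have hw1 : w ≤ 1 := by
    have : α * β ≤ 1 := mul_le_one₀ hα1 hβ.le hβ1
    rw [hw]; linarith
  have hexp : Real.exp (-(s / 16)) ≤ w ^ 16 := by
    calc Real.exp (-(s / 16)) ≤ Real.exp (16 * -L) := Real.exp_le_exp.2 (by linarith)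
      _ = w ^ 16 := by
        rw [hL, ← Real.log_inv, inv_div, mul_comm, Real.exp_mul, Real.exp_log hw0]
        norm_cast
  have hlin : s / 16 * Real.exp (-(s / 16)) ≤ Real.exp (-1) := by
    have := Real.add_one_le_exp (s / 16 - 1)
    calc s / 16 * Real.exp (-(s / 16)) ≤ Real.exp (s / 16 - 1) * Real.exp (-(s / 16)) := by
          gcongr; linarith
      _ = Real.exp (-1) := by rw [← Real.exp_add]; congr 1; ring
  have hcw : c ≤ 32 / α ^ 2 * w ^ 16 := by
    have e1 : c = 32 / α ^ 2 * Real.exp 1 * (s / 16 * Real.exp (-(s / 16))) *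
        Real.exp (-(s / 16)) := by
      have : Real.exp (-(s / 8)) = Real.exp (-(s / 16)) * Real.exp (-(s / 16)) := by
        rw [← Real.exp_add]; congr 1; ring
      rw [hc, this, hs]
      field_simp
      ring
    calc c ≤ 32 / α ^ 2 * Real.exp 1 * Real.exp (-1) * w ^ 16 := by
          rw [e1]
          gcongr
      _ = 32 / α ^ 2 * w ^ 16 := by
          rw [mul_assoc (32 / α ^ 2), ← Real.exp_add]
          simp
  have hcβ : c ≤ β / 4 := by
    calc c ≤ 32 / α ^ 2 * w ^ 16 := hcw
      _ ≤ 32 / α ^ 2 * w ^ 2 := by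
          gcongr 1
          exact pow_le_pow_of_le_one hw0.le hw1 (by norm_num)
      _ = 32 / 48 ^ 2 * (β * β) := by
          rw [hw]
          field_simp
      _ ≤ β / 4 := by nlinarith
  calc 2 * ((2 * n / d * Real.exp 1) ^ d * (2 * Real.exp (-(n * α ^ 2 / 8))))
      = 4 * ((2 * n / d * Real.exp 1) ^ d * Real.exp (-(n * α ^ 2 / 8))) := by ring
    _ = 4 * c ^ d := by rw [hpow]
    _ ≤ 4 * c := by
        gcongr
        exact pow_le_of_le_one hc0 (by linarith) hd.ne'
    _ ≤ β := by linarith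

lemma iidProb_vcDim_le {X : Type u} (p : PMF X) {n d : ℕ} {Q : Set (Set X)} (hQ : vcDim Q ≤ d)
    (hd : 0 < d) {α β : ℝ} (hα : 0 < α) (hα1 : α ≤ 1) (hβ : 0 < β) (hβ1 : β ≤ 1)
    (hn : 256 * d * Real.log (48 / (α * β)) / α ^ 2 ≤ (n : ℝ)) :
    iidProb p {x : Fin n → X | ∃ q ∈ Q, α < |empiricalValue q x - populationValue q p|} ≤
      ENNReal.ofReal β := by
  have hd' : (1 : ℝ) ≤ d := by exact_mod_cast hd
  have hL : 1 ≤ Real.log (48 / (α * β)) := by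
    rw [Real.le_log_iff_exp_le (by positivity), le_div_iff₀ (by positivity)]
    have h1 : α * β ≤ 1 := mul_le_one₀ hα1 hβ.le hβ1
    have h2 := Real.exp_one_lt_d9
    have h3 : Real.exp 1 * (α * β) ≤ Real.exp 1 * 1 := by gcongr
    linarith
  have hnα : 256 * d ≤ n * α ^ 2 := by
    rw [div_le_iff₀ (by positivity)] at hn
    refine le_trans ?_ hn
    exact le_mul_of_one_le_right (by positivity) hL
  have hdn : 256 * (d : ℝ) ≤ n := by
    refine hnα.trans (mul_le_of_le_one_right (Nat.cast_nonneg n) (pow_le_one₀ hα.le hα1))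
  have hdn' : 256 * d ≤ n := by exact_mod_cast hdn
  calc _ ≤ 2 * iidExp p (fun x : Fin n → X => iidProb p {x' : Fin n → X | ∃ q ∈ Q,
        α / 2 < |empiricalValue q x - empiricalValue q x'|}) :=
        iidProb_le_two_mul_ghost p Q hα (by linarith)
    _ = 2 * iidProb (sqPMF p) {z : Fin n → X × X | ∃ q ∈ Q, α / 2 <
          |empiricalValue q (fun i => (z i).1) - empiricalValue q (fun i => (z i).2)|} := by
        unfold iidProb
        rw [iidExp_iidExp]
        rfl
    _ ≤ 2 * ENNReal.ofReal ((2 * n / d * Real.exp 1) ^ d * (2 * Real.exp (-(n * α ^ 2 / 8)))) := by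
        gcongr
        exact iidProb_sqPMF_le p _ fun z =>
          card_swapPairs_le (by omega) hd (by omega) hQ hα.le z
    _ = ENNReal.ofReal
          (2 * ((2 * n / d * Real.exp 1) ^ d * (2 * Real.exp (-(n * α ^ 2 / 8))))) := by
        rw [ENNReal.ofReal_mul (p := 2) (by norm_num)]
        norm_num
    _ ≤ ENNReal.ofReal β := ENNReal.ofReal_le_ofReal (growth_mul_exp_le hd hα hα1 hβ hβ1 hn)

/-! ### Postprocessing of algorithms with countably many outputs -/

/-- Distinct functions are separated by one coordinate, hence by a measurable set. Countably many
such separations carve out any part of `C`, so on countable ranges every postprocessing is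
measurable and preserves privacy. -/
lemma exists_measurableSet_agree {κ : Type u} {C : Set (κ → ℝ)} (hC : C.Countable)
    (T : Set (κ → ℝ)) : ∃ T', MeasurableSet T' ∧ ∀ a ∈ C, a ∈ T' ↔ a ∈ T := by
  have hne (a b : κ → ℝ) : ∃ s : Set (κ → ℝ), MeasurableSet s ∧ a ∈ s ∧ (a ≠ b → b ∉ s) := by
    by_cases h : a = b
    · exact ⟨Set.univ, MeasurableSet.univ, trivial, fun h' => absurd h h'⟩
    · obtain ⟨k, hk⟩ := Function.ne_iff.1 h
      exact ⟨(fun y => y k) ⁻¹' {a k}, measurable_pi_apply k (measurableSet_singleton _), rfl,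
        fun _ hb => hk (Eq.symm hb)⟩
  choose s hs has hbs using hne
  refine ⟨⋃ a ∈ C ∩ T, ⋂ b ∈ C \ T, s a b, ?_, fun b hb => ⟨fun h => ?_, fun h => ?_⟩⟩
  · exact MeasurableSet.biUnion (hC.mono Set.inter_subset_left) fun a _ =>
      MeasurableSet.biInter (hC.mono Set.sdiff_subset) fun b _ => hs a b
  · by_contra hbT
    obtain ⟨a, ha, hab⟩ := Set.mem_iUnion₂.1 h
    have hab' : b ∈ s a b := Set.mem_iInter₂.1 hab b ⟨hb, hbT⟩
    exact hbs a b (fun e => hbT (e ▸ ha.2)) hab'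
  · exact Set.mem_iUnion₂.2 ⟨b, ⟨hb, h⟩, Set.mem_iInter₂.2 fun c _ => has b c⟩

section postprocessing

variable {X : Type u} {n : ℕ} {κ : Type v} {Z : Type*} [MeasurableSpace Z]
  {A : RandAlg.{u, v, w} (Fin n → X) (κ → ℝ)} {f : (κ → ℝ) → Z}

lemma RandAlg.measurable_comp_run (h : Measurable f ∨ A.CountableOutputs) (x : Fin n → X) :
    Measurable fun ω => f (A.run x ω) := by
  rcases h with h | h
  · exact h.comp (A.measurable_run x)
  · intro T _
    obtain ⟨T', hT', hagree⟩ := exists_measurableSet_agree (h x) (f ⁻¹' T)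
    convert A.measurable_run x hT' using 1
    ext ω
    exact (hagree _ ⟨ω, rfl⟩).symm

lemma RandAlg.IsDP.map {ε δ : ℝ} (hA : A.IsDP ε δ) (h : Measurable f ∨ A.CountableOutputs) :
    (A.map f (RandAlg.measurable_comp_run h)).IsDP ε δ := by
  intro x x' hxx' T hT
  rw [RandAlg.prob_map, RandAlg.prob_map]
  rcases h with h | h
  · exact hA x x' hxx' _ (h hT)
  · obtain ⟨T', hT', hagree⟩ := exists_measurableSet_agree ((h x).union (h x')) (f ⁻¹' T)
    have e : A.prob x (f ⁻¹' T) = A.prob x T' := by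
      unfold RandAlg.prob
      congr 1
      ext ω
      exact (hagree _ (Or.inl ⟨ω, rfl⟩)).symm
    have e' : A.prob x' (f ⁻¹' T) = A.prob x' T' := by
      unfold RandAlg.prob
      congr 1
      ext ω
      exact (hagree _ (Or.inr ⟨ω, rfl⟩)).symm
    rw [e, e']
    exact hA x x' hxx' T' hT'

end postprocessing

/-- Union bound over the two sources of failure: an unrepresentative sample (`E`) and inaccurate
answers, each costing `β`. -/
lemma sampleProb_map_le {X : Type u} {n : ℕ} {Q : Set (Set X)} {Z : Type*} [MeasurableSpace Z]
    {A : RandAlg.{u, u, w} (Fin n → X) (Q → ℝ)} {f : (Q → ℝ) → Z} {α β : ℝ}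
    (hf : ∀ x, Measurable fun ω => f (A.run x ω)) (hβ : 0 ≤ β) (hA : IsQueryRelease Q α β A)
    {p : PMF X} {E : Set (Fin n → X)} (hE : iidProb p E ≤ ENNReal.ofReal β) {T : Set Z}
    (hT : ∀ D ∉ E, ∀ a, AccurateAnswers Q α D a → f a ∉ T) :
    (A.map f hf).sampleProb p T ≤ ENNReal.ofReal (2 * β) := by
  rw [RandAlg.sampleProb_eq]
  calc iidExp p (fun x => (A.map f hf).prob x T)
      ≤ iidExp p (fun x => E.indicator (fun _ => 1) x + ENNReal.ofReal β) := by
        refine iidExp_mono p fun D => ?_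
        by_cases hD : D ∈ E
        · rw [Set.indicator_of_mem hD]
          exact le_add_right (RandAlg.prob_le_one _ _ _)
        · exact le_add_left ((A.prob_mono D (S := f ⁻¹' T) (T := {a | ¬ AccurateAnswers Q α D a})
            fun a ha hacc => hT D hD a hacc ha).trans (hA D))
    _ ≤ ENNReal.ofReal β + ENNReal.ofReal β := by
        rw [iidExp_add, iidExp_const]
        gcongr
        exact hE
    _ = ENNReal.ofReal (2 * β) := by rw [← ENNReal.ofReal_add hβ hβ, two_mul]

/-! ### Decoding answers into a distribution -/

/-- There are countably many pairs of a finite set and a subset cut out on it; one query is chosen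
for each. This makes consistency with a database a countable condition even when `Q` is uncountable.
-/
lemma exists_countable_same_traces {X : Type u} [Countable X] (Q : Set (Set X)) :
    ∃ Q₀ : Set Q, Q₀.Countable ∧ ∀ (q : Q) (V : Finset X), ∃ q₀ ∈ Q₀,
      ∀ x ∈ V, x ∈ (q₀ : Set X) ↔ x ∈ (q : Set X) := by
  classical
  let R : Finset X × Finset X → Q → Prop := fun VT q => ∀ x ∈ VT.1, x ∈ (q : Set X) ↔ x ∈ VT.2
  have h (VT : {VT // ∃ q, R VT q}) : ∃ q, R VT q := VT.2
  choose g hg using h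
  refine ⟨Set.range g, Set.countable_range g, fun q V => ?_⟩
  have hR : R (V, V.filter (· ∈ (q : Set X))) q := fun x hx => by simp [hx]
  refine ⟨_, ⟨⟨_, q, hR⟩, rfl⟩, fun x hx => ?_⟩
  rw [hg ⟨_, q, hR⟩ x hx, ← hR x hx]

lemma empiricalValue_congr {X : Type u} {n : ℕ} {q q' : Set X} {D : Fin n → X}
    (h : ∀ i, D i ∈ q ↔ D i ∈ q') : empiricalValue q D = empiricalValue q' D := by
  classical
  simp only [empiricalValue, Set.indicator_apply, h]

lemma abs_sub_le_two_mul {a b c r : ℝ} (h : |a - b| ≤ r) (h' : |a - c| ≤ r) :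
    |b - c| ≤ 2 * r := by
  have := abs_sub_le b a c
  rw [abs_sub_comm b a] at this
  linarith

/-- Any database consistent with the answers will do, by the triangle inequality through `a`. For
countable `X` measurability is obtained by taking the first consistent database in an enumeration;
otherwise an arbitrary choice suffices. -/
lemma exists_decoder {X : Type u} [Nonempty X] {n : ℕ} [NeZero n] (Q : Set (Set X)) (α : ℝ) :
    ∃ f : (Q → ℝ) → PMF X, (Countable X → Measurable f) ∧
      ∀ (D : Fin n → X) (a : Q → ℝ), AccurateAnswers Q α D a →
        ∀ q ∈ Q, |populationValue q (f a) - empiricalValue q D| ≤ 2 * α := by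
  classical
  by_cases hX : Countable X
  · obtain ⟨Q₀, hQ₀, htr⟩ := exists_countable_same_traces Q
    obtain ⟨e, he⟩ := exists_surjective_nat (Fin n → X)
    let C : (Q → ℝ) → ℕ → Prop := fun a k =>
      ∀ q ∈ Q₀, |a q - empiricalValue (q : Set X) (e k)| ≤ α
    -- The second alternative makes the search total: with no consistent database every index
    -- qualifies and index `0` is returned.
    let P : (Q → ℝ) → ℕ → Prop := fun a k => C a k ∨ ¬ ∃ k', C a k'
    have hP (a : Q → ℝ) : ∃ k, P a k := by
      by_cases h : ∃ k, C a k
      · exact h.imp fun k hk => Or.inl hk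
      · exact ⟨0, Or.inr h⟩
    have hC (k : ℕ) : MeasurableSet {a | C a k} := by
      have : {a | C a k} = ⋂ q ∈ Q₀, {a | |a q - empiricalValue (q : Set X) (e k)| ≤ α} := by
        ext a
        simp [C]
      rw [this]
      refine MeasurableSet.biInter hQ₀ fun q _ => measurableSet_le ?_ measurable_const
      exact ((measurable_pi_apply q).sub_const _).norm
    have hPm (k : ℕ) : MeasurableSet {a | P a k} := by
      have h2 : MeasurableSet {a | ∃ k', C a k'} := by
        have : {a | ∃ k', C a k'} = ⋃ k', {a | C a k'} := by
          ext a
          simp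
        rw [this]
        exact MeasurableSet.iUnion hC
      exact (hC k).union h2.compl
    refine ⟨fun a => empiricalPMF (e (Nat.find (hP a))), fun _ =>
      (measurable_from_nat (f := fun k => empiricalPMF (e k))).comp (measurable_find hP hPm),
      fun D a ha q hq => ?_⟩
    obtain ⟨k, hk⟩ := he D
    have hfind : C a (Nat.find (hP a)) := by
      rcases Nat.find_spec (hP a) with h | h
      · exact h
      · exact absurd ⟨k, fun q _ => by rw [hk]; exact ha q⟩ h
    set D' := e (Nat.find (hP a))
    -- Consistency was tested only on `Q₀`, but `q` has the same values on `D` and `D'` as some `q₀`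
    -- there.
    obtain ⟨q₀, hq₀, htr₀⟩ := htr ⟨q, hq⟩ (Finset.univ.image D ∪ Finset.univ.image D')
    have h1 : empiricalValue (q₀ : Set X) D = empiricalValue q D :=
      empiricalValue_congr fun i => htr₀ _ (by simp)
    have h2 : empiricalValue (q₀ : Set X) D' = empiricalValue q D' :=
      empiricalValue_congr fun i => htr₀ _ (by simp)
    rw [populationValue_empiricalPMF, ← h1, ← h2]
    exact abs_sub_le_two_mul (hfind q₀ hq₀) (ha q₀)
  · let f : (Q → ℝ) → PMF X := fun a =>
      if h : ∃ D : Fin n → X, AccurateAnswers Q α D a then empiricalPMF h.choose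
      else PMF.pure (Classical.arbitrary X)
    refine ⟨f, fun h => absurd h hX, fun D a ha q hq => ?_⟩
    have h : ∃ D : Fin n → X, AccurateAnswers Q α D a := ⟨D, ha⟩
    simp only [f, dif_pos h, populationValue_empiricalPMF]
    exact abs_sub_le_two_mul (h.choose_spec ⟨q, hq⟩) (ha ⟨q, hq⟩)

lemma exists_distLearner_of_uniform {X : Type u} [Nonempty X] {n : ℕ} [NeZero n]
    {Q : Set (Set X)} {ε δ α β : ℝ} (hα : 0 ≤ α) (hβ : 0 ≤ β)
    (hUC : ∀ p : PMF X, iidProb p {x : Fin n → X | ∃ q ∈ Q,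
      α < |empiricalValue q x - populationValue q p|} ≤ ENNReal.ofReal β)
    (A : RandAlg.{u, u, w} (Fin n → X) (Q → ℝ)) (hcount : Countable X ∨ A.CountableOutputs)
    (hA : A.IsDP ε δ) (hQ : IsQueryRelease Q α β A) :
    ∃ B : RandAlg.{u, u, w} (Fin n → X) (PMF X),
      B.IsDP ε δ ∧ IsDistLearner Q (3 * α) (2 * β) B := by
  obtain ⟨f, hfm, hf⟩ := exists_decoder (n := n) Q α
  refine ⟨_, hA.map (hcount.imp_left hfm), fun p => sampleProb_map_le _ hβ hQ (hUC p) ?_⟩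
  intro D hD a ha
  refine not_not.2 (queryDist_le (by positivity) fun q hq => ?_)
  have h1 : |empiricalValue q D - populationValue q p| ≤ α :=
    not_lt.1 fun h => hD ⟨q, hq, h⟩
  have h2 := hf D a ha q hq
  have h3 := abs_sub_le (populationValue q p) (empiricalValue q D) (populationValue q (f a))
  rw [abs_sub_comm] at h1 h2
  linarith

/-- Disposes of the degenerate parameters, for which a constant output already succeeds. -/
lemma exists_distLearner_of_one_le {X : Type u} [Nonempty X] (n : ℕ) (Q : Set (Set X))
    {ε α β : ℝ} (hε : 0 ≤ ε) (δ : ℝ) (h : 1 ≤ α ∨ 1 ≤ β) :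
    ∃ B : RandAlg.{u, u, w} (Fin n → X) (PMF X), B.IsDP ε δ ∧ IsDistLearner Q α β B := by
  refine ⟨RandAlg.const _ (PMF.pure (Classical.arbitrary X)), RandAlg.isDP_const hε δ _,
    fun p => ?_⟩
  rcases h with h | h
  · have hempty : {p' | ¬ queryDist Q p p' ≤ α} = ∅ :=
      Set.eq_empty_of_forall_notMem fun p' hp' => hp' (queryDist_le (by linarith) fun q _ =>
        (abs_populationValue_sub_le_one q p p').trans h)
    rw [hempty, RandAlg.sampleProb_eq]
    simp [RandAlg.prob, iidExp]
  · refine (RandAlg.sampleProb_le_one _ _ _).trans ?_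
    simpa using ENNReal.ofReal_le_ofReal h

/-! ### Decoding answers to threshold queries into a CDF -/

section cdf

variable {X : Type u} [LinearOrder X]

open Classical in
/-- The smallest CDF above the answers truncated to `[0, 1]`. -/
noncomputable def cdfDecoder (a : thresh X → ℝ) (t : X) : ℝ :=
  if IsTop t then 1 else ⨆ s : Set.Iic t, max 0 (min 1 (a ⟨Set.Iic s.1, s.1, rfl⟩))

lemma truncate_le_one (r : ℝ) : max 0 (min 1 r) ≤ 1 :=
  max_le zero_le_one (min_le_left _ _)

lemma bddAbove_cdfDecoder (a : thresh X → ℝ) (t : X) : BddAbove (Set.range fun s : Set.Iic t =>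
    max 0 (min 1 (a ⟨Set.Iic s.1, s.1, rfl⟩))) :=
  ⟨1, by rintro _ ⟨s, rfl⟩; exact truncate_le_one _⟩

lemma isCDF_cdfDecoder (a : thresh X → ℝ) : IsCDF (cdfDecoder a) := by
  have hle (t : X) : cdfDecoder a t ≤ 1 := by
    unfold cdfDecoder
    split_ifs
    · exact le_rfl
    · exact Real.iSup_le (fun s => truncate_le_one _) zero_le_one
  refine ⟨fun t t' htt' => ?_, fun t => ?_, hle, fun m hm => if_pos hm⟩
  · by_cases ht' : IsTop t'
    · exact (hle t).trans_eq (if_pos ht').symm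
    · have ht : ¬ IsTop t := fun h => ht' fun x => (h x).trans htt'
      rw [cdfDecoder, cdfDecoder, if_neg ht, if_neg ht']
      have : Nonempty (Set.Iic t) := ⟨⟨t, le_rfl⟩⟩
      exact ciSup_le fun s => le_ciSup (bddAbove_cdfDecoder a t') ⟨s.1, s.2.trans htt'⟩
  · unfold cdfDecoder
    split_ifs
    · exact zero_le_one
    · exact Real.iSup_nonneg fun s => le_max_left _ _

lemma measurable_cdfDecoder [Countable X] : Measurable (cdfDecoder (X := X)) := by
  refine measurable_pi_lambda _ fun t => ?_
  unfold cdfDecoder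
  by_cases ht : IsTop t
  · simp only [ht, if_true]
    exact measurable_const
  · simp only [ht, if_false]
    exact Measurable.iSup fun s =>
      measurable_const.max (measurable_const.min (measurable_pi_apply _))

/-- Truncation to `[0, 1]` and the running supremum do not increase the distance to `cdfOf p`,
because the latter is `[0, 1]`-valued and monotone; at a maximum both sides are `1`. -/
lemma abs_cdfDecoder_sub_le {p : PMF X} {a : thresh X → ℝ} {r : ℝ} (hr : 0 ≤ r)
    (h : ∀ s : X, |a ⟨Set.Iic s, s, rfl⟩ - cdfOf p s| ≤ r) (t : X) :
    |cdfDecoder a t - cdfOf p t| ≤ r := by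
  by_cases ht : IsTop t
  · have h1 : cdfOf p t = 1 := by
      have h2 : p.toOuterMeasure (Set.Iic t) = 1 :=
        (PMF.toOuterMeasure_apply_eq_one_iff p (Set.Iic t)).2 fun x _ => ht x
      rw [cdfOf, h2, ENNReal.toReal_one]
    rw [h1, cdfDecoder, if_pos ht, sub_self, abs_zero]
    exact hr
  · rw [cdfDecoder, if_neg ht]
    have hne : Nonempty (Set.Iic t) := ⟨⟨t, le_rfl⟩⟩
    have h0 : 0 ≤ cdfOf p t := populationValue_nonneg _ p
    have h1 : cdfOf p t ≤ 1 := populationValue_le_one _ p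
    rw [abs_le, le_sub_iff_add_le, sub_le_iff_le_add]
    constructor
    · refine le_trans ?_ (le_ciSup (bddAbove_cdfDecoder a t) ⟨t, le_rfl⟩)
      have := (abs_le.1 (h t)).1
      exact le_max_of_le_right (le_min (by linarith) (by linarith))
    · refine ciSup_le fun s => max_le (by linarith) (min_le_of_right_le ?_)
      have h2 := (abs_le.1 (h s.1)).2
      have h3 : cdfOf p s.1 ≤ cdfOf p t := populationValue_mono p (Set.Iic_subset_Iic.2 s.2)
      linarith

lemma exists_kolmogorovLearner {n : ℕ} {ε δ α β : ℝ} (hα : 0 < α) (hβ : 0 < β)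
    (hn : 2 * Real.log (2 / β) / α ^ 2 ≤ (n : ℝ))
    (A : RandAlg.{u, u, w} (Fin n → X) (thresh X → ℝ))
    (hcount : Countable X ∨ A.CountableOutputs) (hA : A.IsDP ε δ)
    (hQ : IsQueryRelease (thresh X) α β A) :
    ∃ B : RandAlg.{u, u, w} (Fin n → X) (X → ℝ),
      B.IsDP ε δ ∧ IsKolmogorovLearner (2 * α) (2 * β) B := by
  refine ⟨_, hA.map (f := cdfDecoder) (hcount.imp_left fun (_ : Countable X) => measurable_cdfDecoder),
    fun x ω => isCDF_cdfDecoder _, fun p => ?_⟩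
  rcases le_total β (1 / 2) with hβ2 | hβ2
  · refine sampleProb_map_le _ hβ.le hQ (iidProb_thresh_le p hα hβ hβ2 hn) ?_
    intro D hD a ha
    refine not_not.2 (Real.iSup_le (fun t => ?_) (by positivity))
    refine abs_cdfDecoder_sub_le (by positivity) (fun s => ?_) t
    have h1 : |empiricalValue (Set.Iic s) D - cdfOf p s| ≤ α :=
      not_lt.1 fun h => hD ⟨Set.Iic s, ⟨s, rfl⟩, h⟩
    have h2 := ha ⟨Set.Iic s, s, rfl⟩
    have := abs_sub_le (a ⟨Set.Iic s, s, rfl⟩) (empiricalValue (Set.Iic s) D) (cdfOf p s)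
    linarith
  -- For `β ≥ 1/2` the allowed failure probability `2β` is at least `1`.
  · refine (RandAlg.sampleProb_le_one _ _ _).trans ?_
    simpa using ENNReal.ofReal_le_ofReal (by linarith : 1 ≤ 2 * β)

end cdf

/-! ### Distribution learners from query release: degenerate parameters and assembly -/

lemma exists_distLearner_of_vcDim {X : Type u} [Nonempty X] {n d : ℕ} {Q : Set (Set X)}
    {ε δ α β : ℝ} (hε : 0 ≤ ε) (hα : 0 < α) (hβ : 0 < β) (hQd : vcDim Q ≤ d) (hd : 1 ≤ d)
    (hn : 256 * d * Real.log (48 / (α * β)) / α ^ 2 ≤ (n : ℝ))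
    (A : RandAlg.{u, u, w} (Fin n → X) (Q → ℝ)) (hcount : Countable X ∨ A.CountableOutputs)
    (hA : A.IsDP ε δ) (hQ : IsQueryRelease Q α β A) :
    ∃ B : RandAlg.{u, u, w} (Fin n → X) (PMF X),
      B.IsDP ε δ ∧ IsDistLearner Q (3 * α) (2 * β) B := by
  by_cases h : 1 ≤ α ∨ 1 ≤ β
  · exact exists_distLearner_of_one_le n Q hε δ (h.imp (fun h => by linarith) fun h => by linarith)
  push Not at h
  have hn0 : n ≠ 0 := by
    rintro rfl
    have h1 : α * β < 1 := mul_lt_one_of_nonneg_of_lt_one_left hα.le h.1 h.2.le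
    have h2 : 0 < Real.log (48 / (α * β)) :=
      Real.log_pos ((one_lt_div (by positivity)).2 (by linarith))
    have h3 : (0 : ℝ) < d := by exact_mod_cast hd
    have h4 : 0 < 256 * d * Real.log (48 / (α * β)) / α ^ 2 := by positivity
    rw [Nat.cast_zero] at hn
    linarith
  have : NeZero n := ⟨hn0⟩
  exact exists_distLearner_of_uniform hα.le hβ.le
    (fun p => iidProb_vcDim_le p hQd hd hα h.1.le hβ h.2.le hn) A hcount hA hQ

lemma exists_distLearner_thresh {X : Type u} [LinearOrder X] [Nonempty X] {n : ℕ}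
    {ε δ α β : ℝ} (hε : 0 ≤ ε) (hα : 0 < α) (hβ : 0 < β)
    (hn : 2 * Real.log (2 / β) / α ^ 2 ≤ (n : ℝ))
    (A : RandAlg.{u, u, w} (Fin n → X) (thresh X → ℝ))
    (hcount : Countable X ∨ A.CountableOutputs) (hA : A.IsDP ε δ)
    (hQ : IsQueryRelease (thresh X) α β A) :
    ∃ B : RandAlg.{u, u, w} (Fin n → X) (PMF X),
      B.IsDP ε δ ∧ IsDistLearner (thresh X) (3 * α) (2 * β) B := by
  rcases le_total (1 / 2) β with h | h
  · exact exists_distLearner_of_one_le n _ hε δ (Or.inr (by linarith))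
  have hn0 : n ≠ 0 := by
    rintro rfl
    have h2 : 0 < Real.log (2 / β) := Real.log_pos ((one_lt_div hβ).2 (by linarith))
    have h4 : 0 < 2 * Real.log (2 / β) / α ^ 2 := by positivity
    rw [Nat.cast_zero] at hn
    linarith
  have : NeZero n := ⟨hn0⟩
  exact exists_distLearner_of_uniform hα.le hβ.le
    (fun p => iidProb_thresh_le p hα hβ h hn) A hcount hA hQ

end DPLearn

theorem mainTheorem4 {X : Type u} [Nonempty X] (n : ℕ) (ε δ α β : ℝ)
    (hε : 0 ≤ ε) (hδ : 0 ≤ δ) (hα : 0 < α) (hβ : 0 < β) :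
    -- query release yields distribution learning
    (∀ (Q : Set (Set X)) (d : ℕ), DPLearn.vcDim Q = d → 1 ≤ d →
      256 * d * Real.log (48 / (α * β)) / α ^ 2 ≤ (n : ℝ) →
      ∀ A : DPLearn.RandAlg.{u, u, w} (Fin n → X) (Q → ℝ),
        Countable X ∨ A.CountableOutputs →
        A.IsDP ε δ → DPLearn.IsQueryRelease Q α β A →
        ∃ B : DPLearn.RandAlg.{u, u, w} (Fin n → X) (PMF X),
          B.IsDP ε δ ∧ DPLearn.IsDistLearner Q (3 * α) (2 * β) B) ∧
    -- distribution learning yields query release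
    (ε ≤ 1 → ∀ (Q : Set (Set X)) (A : DPLearn.RandAlg.{u, u, w} (Fin n → X) (PMF X)),
      A.IsDP ε δ → DPLearn.IsDistLearner Q α β A →
      ∃ B : DPLearn.RandAlg.{u, u, w} (Fin (9 * n) → X) (Q → ℝ),
        B.IsDP ε δ ∧ DPLearn.IsQueryRelease Q α β B) ∧
    -- thresholds
    (∀ _ : LinearOrder X, 2 * Real.log (2 / β) / α ^ 2 ≤ (n : ℝ) →
      ∀ A : DPLearn.RandAlg.{u, u, w} (Fin n → X) (DPLearn.thresh X → ℝ),
        Countable X ∨ A.CountableOutputs →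
        A.IsDP ε δ → DPLearn.IsQueryRelease (DPLearn.thresh X) α β A →
        (∃ B : DPLearn.RandAlg.{u, u, w} (Fin n → X) (PMF X),
          B.IsDP ε δ ∧ DPLearn.IsDistLearner (DPLearn.thresh X) (3 * α) (2 * β) B) ∧
        (∃ B : DPLearn.RandAlg.{u, u, w} (Fin n → X) (X → ℝ),
          B.IsDP ε δ ∧ DPLearn.IsKolmogorovLearner (2 * α) (2 * β) B)) := by
  refine ⟨fun Q d hQ hd hn A hcount hA hQA => ?_, fun hε1 Q A hA hQA => ?_,
    fun _ hn A hcount hA hQA => ⟨?_, ?_⟩⟩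
  · exact DPLearn.exists_distLearner_of_vcDim hε hα hβ hQ.le hd hn A hcount hA hQA
  · exact DPLearn.exists_queryRelease_of_distLearner hε hε1 hδ hα.le Q A hA hQA
  · exact DPLearn.exists_distLearner_thresh hε hα hβ hn A hcount hA hQA
  · exact DPLearn.exists_kolmogorovLearner hα hβ hn A hcount hA hQA
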